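/- Let $n\ge 0$, and let $(x,p;\xi_x,\xi_p)$ denote points of $\mathbb R^{2n}\oplus\mathbb R^{2n}$, with $\xi_x,\xi_p\in\mathbb R^n$ conjugate to $x,p\in\mathbb R^n$. For an operator $T:\mathcal S(\mathbb R^d)\to\mathcal S'(\mathbb R^d)$ with distribution kernel $K\in\mathcal S'(\mathbb R^d\times\mathbb R^d)$, i.e. $\langle T\psi,\varphi\rangle=\langle K(x,y),\varphi(x)\psi(y)\rangle$, its Weyl symbol is $a(x,\xi)=\int e^{-i\xi\cdot y}K(x+\tfrac y2,x-\tfrac y2)\,dy\in\mathcal S'(\mathbb R^{2d})$, in the sense of distributions. For $a\in\mathcal S'(\mathbb R^n\times\mathbb R^n)$ let $\hat A:\mathcal S(\mathbb R^{2n})\to\mathcal S'(\mathbb R^{2n})$ be the phase-space extension of the Weyl operator with symbol $a$, $$\hat A\Psi(x,p)=\frac1{(2\pi)^n}\int_{\mathbb R^{2n}}e^{i(x-x')\cdot\xi_x}\,a\big(\tfrac12(x+x'),\xi_x\big)\,\Psi(x',p)\,dx'\,d\xi_x$$ in the sense of distributions, that is $\langle\hat A\Psi,\mathrm X\rangle=\big\langle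 K_a(x,x'),\int \mathrm X(x,p)\Psi(x',p)\,dp\big\rangle$ with $K_a(x,x')=(2\pi)^{-n}\int e^{i(x-x')\cdot\xi}a(\tfrac{x+x'}2,\xi)\,d\xi$. Let $\hat S=\hat U(\theta_0)$, $\theta_0=\tfrac{\sqrt7}7\arccos\tfrac34$, where $$\hat U(\theta)=\mathcal F^{-1}\,\hat T(\theta)\,\mathcal F,\qquad \mathcal F\Psi(x,\xi_p)=(2\pi)^{-n/2}\int e^{-i\xi_p\cdot p}\Psi(x,p)\,dp,\qquad \hat T(\theta)\Phi(x,\xi_p)=\Phi(x(-\theta),\xi_p(-\theta)),$$ and, with $k=\sqrt7$, $x(\theta)=x(\cos k\theta-k^{-1}\sin k\theta)+2k^{-1}\xi_p\sin k\theta$, $\xi_p(\theta)=\xi_p(\cos k\theta+k^{-1}\sin k\theta)-4k^{-1}x\sin k\theta$. The operator $\hat S$ is an isomorphism of $\mathcal S(\mathbb R^{2n})$, and it is extended to $\mathcal S'(\mathbb R^{2n})$ by duality. The Bopp operator is $\hat A_B=\hat S\hat A\hat S^{-1}:\mathcal S(\mathbb R^{2n})\to\mathcal S'(\mathbb R^{2n})$.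 Then for every $a\in\mathcal S'(\mathbb R^n\times\mathbb R^n)$ the operator $\hat A_B$ is a pseudo-differential operator (a continuous linear operator $\mathcal S(\mathbb R^{2n})\to\mathcal S'(\mathbb R^{2n})$) with Weyl symbol $$A_B(x,p;\xi_x,\xi_p)=a\big(x-\tfrac{\xi_p}2,\;p+\tfrac{\xi_x}2\big)\in\mathcal S'(\mathbb R^{4n}).$$ In particular (formally, $\hat A_B=a(x+\tfrac i2\partial_p,\,p-\tfrac i2\partial_x)$), for $1\le j\le n$ and on $\mathcal S(\mathbb R^{2n})$: if $a(x,\xi_x)=x_j$ then $\hat A_B=x_j+\tfrac i2\partial_{p_j}$, and if $a(x,\xi_x)=(\xi_x)_j$ then $\hat A_B=p_j-\tfrac i2\partial_{x_j}$. -/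

import Mathlib

open MeasureTheory SchwartzMap
open scoped ContDiff

namespace Bopp

/-- A nondegenerate bilinear form `x · y`, used as the duality pairing between positions and
momenta. -/
class DotProduct (Y : Type) [NormedAddCommGroup Y] [NormedSpace ℝ Y] where
  /-- the bilinear form -/
  dot : Y →L[ℝ] Y →L[ℝ] ℝ
  nondeg : ∀ y, dot y = 0 → y = 0

open DotProduct

/-- The Euclidean dot product on `ℝⁿ`. -/
noncomputable instance instDotEuclidean (n : ℕ) : DotProduct (EuclideanSpace ℝ (Fin n)) where
  dot := innerSL ℝ
  nondeg y h := by
    have h' : inner ℝ y y = (0 : ℝ) := congrArg (fun f => f y) h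
    exact inner_self_eq_zero.mp h'

/-- On a product, `(x, p) · (ξ, η) = x · ξ + p · η`. -/
noncomputable instance instDotProd (X Y : Type) [NormedAddCommGroup X] [NormedSpace ℝ X]
    [NormedAddCommGroup Y] [NormedSpace ℝ Y] [DotProduct X] [DotProduct Y] :
    DotProduct (X × Y) where
  dot := (dot (Y := X)).bilinearComp (ContinuousLinearMap.fst ℝ X Y)
      (ContinuousLinearMap.fst ℝ X Y) +
    (dot (Y := Y)).bilinearComp (ContinuousLinearMap.snd ℝ X Y) (ContinuousLinearMap.snd ℝ X Y)
  nondeg := by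
    rintro ⟨x, y⟩ h
    have hx : x = 0 := nondeg x <| by
      ext v
      simpa using congrArg (fun f => f (v, 0)) h
    have hy : y = 0 := nondeg y <| by
      ext v
      simpa using congrArg (fun f => f (0, v)) h
    rw [hx, hy, Prod.mk_zero_zero]

instance instHaarProd (X Y : Type) [NormedAddCommGroup X] [NormedSpace ℝ X]
    [NormedAddCommGroup Y] [NormedSpace ℝ Y] [MeasureSpace X] [MeasureSpace Y] [BorelSpace X]
    [BorelSpace Y] [FiniteDimensional ℝ X] [FiniteDimensional ℝ Y]
    [(volume : Measure X).IsAddHaarMeasure] [(volume : Measure Y).IsAddHaarMeasure] :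
    (volume : Measure (X × Y)).IsAddHaarMeasure :=
  haveI : ProperSpace X := FiniteDimensional.proper ℝ X
  haveI : ProperSpace Y := FiniteDimensional.proper ℝ Y
  inferInstanceAs ((volume : Measure X).prod (volume : Measure Y)).IsAddHaarMeasure

section Transform

set_option linter.unusedSectionVars false

variable {X Y G : Type} [NormedAddCommGroup X] [NormedSpace ℝ X] [NormedAddCommGroup Y]
  [NormedSpace ℝ Y] [NormedAddCommGroup G] [NormedSpace ℝ G]
  [NormedSpace ℂ G] [SMulCommClass ℝ ℂ G] [IsScalarTower ℝ ℂ G] [DotProduct Y]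
  [FiniteDimensional ℝ Y] [MeasureSpace Y] [BorelSpace Y]
  [(volume : Measure Y).IsAddHaarMeasure]

/-- `osc f (x, ξ) = ∫ e^{-i ξ·p} f(x, p) dp`. -/
noncomputable def osc (f : X × Y → G) (z : X × Y) : G :=
  ∫ p : Y, Complex.exp (-(Complex.I * (dot z.2 p : ℝ))) • f (z.1, p)

theorem norm_exp_dot (r : ℝ) : ‖Complex.exp (-(Complex.I * (r : ℝ)))‖ = 1 := by
  rw [Complex.norm_exp]; simp

/-- Precomposition by a real linear map, as a complex linear operation. -/
noncomputable def precompC {V W : Type} [NormedAddCommGroup V] [NormedSpace ℝ V]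
    [NormedAddCommGroup W] [NormedSpace ℝ W] (P : V →L[ℝ] W) :
    (W →L[ℝ] G) →L[ℂ] (V →L[ℝ] G) :=
  LinearMap.mkContinuous
    { toFun := fun T => T.comp P
      map_add' := fun _ _ => rfl
      map_smul' := fun _ _ => rfl } ‖P‖
    (fun T => by rw [mul_comm]; exact T.opNorm_comp_le P)

/-- The Schwartz function whose oscillatory integral is the derivative of that of `f`. -/
noncomputable def oscD : 𝓢(X × Y, G) →L[ℂ] 𝓢(X × Y, X × Y →L[ℝ] G) :=
  (postcompCLM (precompC ((ContinuousLinearMap.inl ℝ X Y).comp (ContinuousLinearMap.fst ℝ X Y))))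
      ∘L fderivCLM ℂ (X × Y) G -
    Complex.I • smulRightCLM ℂ G ((dot (Y := Y)).bilinearComp (ContinuousLinearMap.snd ℝ X Y)
      (ContinuousLinearMap.snd ℝ X Y)).flip

/-- The partial derivative in the integrated variable. -/
noncomputable def oscP : 𝓢(X × Y, G) →L[ℂ] 𝓢(X × Y, Y →L[ℝ] G) :=
  (postcompCLM (precompC (ContinuousLinearMap.inr ℝ X Y))) ∘L fderivCLM ℂ (X × Y) G

/-- Uniform integrable bound of a Schwartz function in the second variable. -/
theorem exists_bound (k : ℕ) : ∃ (g : Y → ℝ) (q : Seminorm ℂ 𝓢(X × Y, G)), Integrable g ∧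
    (∀ p, 0 ≤ g p) ∧ Continuous q ∧
    ∀ (f : 𝓢(X × Y, G)) (x : X) (p : Y), ‖x‖ ^ k * ‖f (x, p)‖ ≤ g p * q f := by
  obtain ⟨N, hN⟩ := (inferInstance : (volume : Measure Y).HasTemperateGrowth).exists_integrable
  let m : ℕ × ℕ := (N + k, 0)
  let q : Seminorm ℂ 𝓢(X × Y, G) :=
    (Finset.Iic m).sup (fun m => SchwartzMap.seminorm ℂ m.1 m.2)
  refine ⟨fun p => 2 ^ m.1 * (1 + ‖p‖) ^ (-(N : ℝ)), q, hN.const_mul _,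
    fun p => by positivity, ?_, fun f x p => ?_⟩
  · have hc : ∀ i ∈ Finset.Iic m,
        Continuous (SchwartzMap.seminorm ℂ (E := X × Y) (F := G) i.1 i.2) :=
      fun i _ => (schwartz_withSeminorms ℂ (X × Y) G).continuous_seminorm i
    exact Seminorm.continuous_finsetSup hc
  · have h := one_add_le_sup_seminorm_apply (𝕜 := ℂ) (m := m) (k := N + k) (n := 0) le_rfl le_rfl
      f (x, p)
    rw [norm_iteratedFDeriv_zero] at h
    have h1 : (1 + ‖p‖) ^ N * ‖x‖ ^ k ≤ (1 + ‖((x, p) : X × Y)‖) ^ (N + k) := by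
      rw [pow_add]
      have := norm_snd_le (x, p)
      have := norm_fst_le (x, p)
      gcongr
      linarith
    show _ ≤ 2 ^ m.1 * (1 + ‖p‖) ^ (-(N : ℝ)) * q f
    rw [Real.rpow_neg (by positivity), Real.rpow_natCast]
    have h2 : (1 + ‖p‖) ^ N * (‖x‖ ^ k * ‖f (x, p)‖) ≤ 2 ^ m.1 * q f := by
      calc _ = (1 + ‖p‖) ^ N * ‖x‖ ^ k * ‖f (x, p)‖ := by ring
        _ ≤ (1 + ‖((x, p) : X × Y)‖) ^ (N + k) * ‖f (x, p)‖ := by gcongr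
        _ ≤ _ := h
    rw [← le_div_iff₀' (by positivity)] at h2
    exact h2.trans_eq (by field_simp)

theorem osc_integrable (f : 𝓢(X × Y, G)) (x : X) : Integrable (fun p => f (x, p)) := by
  obtain ⟨g, q, hg, _, _, h⟩ := exists_bound (X := X) (Y := Y) (G := G) 0
  refine (hg.mul_const (q f)).mono' (by fun_prop) (Filter.Eventually.of_forall fun p => ?_)
  simpa using h f x p


theorem ofReal_smul' (r : ℝ) (x : G) : ((r : ℝ) : ℂ) • x = r • x := algebraMap_smul ℂ r x

theorem oscD_apply (f : 𝓢(X × Y, G)) (w : X × Y) (v : X × Y) :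
    oscD f w v = fderiv ℝ f w (v.1, 0) - Complex.I • ((dot v.2 w.2 : ℝ) : ℂ) • f w := by
  rw [ofReal_smul']
  rfl

theorem oscP_apply (f : 𝓢(X × Y, G)) (w : X × Y) (v : Y) :
    oscP f w v = fderiv ℝ f w (0, v) := rfl

theorem osc_integrand_hasFDerivAt (f : 𝓢(X × Y, G)) (p : Y) (w : X × Y) :
    HasFDerivAt (fun w : X × Y => Complex.exp (-(Complex.I * (dot w.2 p : ℝ))) • f (w.1, p))
      (Complex.exp (-(Complex.I * (dot w.2 p : ℝ))) • oscD f (w.1, p)) w := by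
  have h1 : HasFDerivAt (fun w : X × Y => Complex.exp (-(Complex.I * (dot w.2 p : ℝ))))
      ((((dot (Y := Y)).flip p).comp (ContinuousLinearMap.snd ℝ X Y)).smulRight
        (Complex.exp (-(Complex.I * (dot w.2 p : ℝ))) * (-Complex.I))) w := by
    have h0 : HasFDerivAt (fun w : X × Y => (dot w.2 p : ℝ))
        (((dot (Y := Y)).flip p).comp (ContinuousLinearMap.snd ℝ X Y)) w :=
      (((dot (Y := Y)).flip p).comp (ContinuousLinearMap.snd ℝ X Y)).hasFDerivAt
    have := (((Complex.ofRealCLM.hasFDerivAt.comp w h0).const_mul Complex.I).neg).cexp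
    refine this.congr_fderiv ?_
    apply ContinuousLinearMap.ext
    intro v
    simp
    ring
  have h2 : HasFDerivAt (fun w : X × Y => f (w.1, p))
      ((fderiv ℝ f (w.1, p)).comp
        ((ContinuousLinearMap.inl ℝ X Y).comp (ContinuousLinearMap.fst ℝ X Y))) w := by
    refine HasFDerivAt.comp (g := f) w (f.hasFDerivAt (w.1, p)) ?_
    refine (hasFDerivAt_fst.prodMk (hasFDerivAt_const p w)).congr_fderiv ?_
    ext v <;> simp
  refine (h1.smul h2).congr_fderiv ?_
  apply ContinuousLinearMap.ext
  intro v
  have e1 : (Complex.exp (-(Complex.I * (dot w.2 p : ℝ))) • oscD f (w.1, p)) v =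
    Complex.exp (-(Complex.I * (dot w.2 p : ℝ))) • (oscD f (w.1, p) v) := rfl
  rw [e1, oscD_apply, smul_sub, sub_eq_add_neg]
  simp only [_root_.add_apply, ContinuousLinearMap.smulRight_apply]
  congr 1
  simp only [← ofReal_smul', smul_smul, ← neg_smul]
  congr 1
  simp
  ring

theorem osc_integrand_integrable (f : 𝓢(X × Y, G)) (z : X × Y) :
    Integrable (fun p => Complex.exp (-(Complex.I * (dot z.2 p : ℝ))) • f (z.1, p)) := by
  refine (osc_integrable f z.1).mono (Continuous.aestronglyMeasurable (by fun_prop))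
    (Filter.Eventually.of_forall fun p => ?_)
  rw [norm_smul, norm_exp_dot, one_mul]

theorem osc_hasFDerivAt (f : 𝓢(X × Y, G)) (z : X × Y) :
    HasFDerivAt (osc f) (osc (oscD f) z) z := by
  obtain ⟨g, q, hg, _, _, h⟩ := exists_bound (X := X) (Y := Y) (G := X × Y →L[ℝ] G) 0
  have h1 := fun w : X × Y => (osc_integrand_integrable f w).aestronglyMeasurable
  have h2 := osc_integrand_integrable f z
  have h3 := (osc_integrand_integrable (oscD f) z).aestronglyMeasurable
  have h4 : ∀ (p : Y) (w : X × Y),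
      ‖Complex.exp (-(Complex.I * (dot w.2 p : ℝ))) • oscD f (w.1, p)‖ ≤ g p * q (oscD f) := by
    intro p w
    have h0 := h (oscD f) w.1 p
    rw [pow_zero, one_mul] at h0
    rw [norm_smul, norm_exp_dot, one_mul]
    exact h0
  have h5 := fun (p : Y) (w : X × Y) => osc_integrand_hasFDerivAt f p w
  have := hasFDerivAt_integral_of_dominated_of_fderiv_le (𝕜 := ℝ) (s := Set.univ) (x₀ := z)
    (μ := volume)
    (F := fun w p => Complex.exp (-(Complex.I * (dot w.2 p : ℝ))) • f (w.1, p))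
    (F' := fun w p => Complex.exp (-(Complex.I * (dot w.2 p : ℝ))) • oscD f (w.1, p))
    (bound := fun p => g p * q (oscD f)) Filter.univ_mem
    (Filter.Eventually.of_forall h1) h2 h3
    (Filter.Eventually.of_forall fun p w _ => h4 p w) (hg.mul_const _)
    (Filter.Eventually.of_forall fun p w _ => h5 p w)
  exact this

theorem osc_oscP (f : 𝓢(X × Y, G)) (z : X × Y) (v : Y) :
    osc (oscP f) z v = Complex.I • ((dot z.2 v : ℝ) : ℂ) • osc f z := by
  have e1 : osc (oscP f) z v =
      ∫ p : Y, Complex.exp (-(Complex.I * (dot z.2 p : ℝ))) • fderiv ℝ f (z.1, p) (0, v) :=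
    ContinuousLinearMap.integral_apply (osc_integrand_integrable (oscP f) z) v
  have i1 : Integrable (fun p : Y =>
      Complex.exp (-(Complex.I * (dot z.2 p : ℝ))) • fderiv ℝ f (z.1, p) (0, v)) :=
    (osc_integrand_integrable (oscP f) z).apply_continuousLinearMap v
  have hE : ∀ p : Y, HasFDerivAt (fun p : Y => Complex.exp (-(Complex.I * (dot z.2 p : ℝ))))
      ((dot z.2).smulRight (Complex.exp (-(Complex.I * (dot z.2 p : ℝ))) * (-Complex.I))) p := by
    intro p
    have := (((Complex.ofRealCLM.hasFDerivAt.comp p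
      (dot z.2).hasFDerivAt).const_mul Complex.I).neg).cexp
    refine this.congr_fderiv ?_
    apply ContinuousLinearMap.ext
    intro v
    simp
    ring
  have hF : ∀ p : Y, HasFDerivAt (fun p : Y => f (z.1, p))
      ((fderiv ℝ f (z.1, p)).comp (ContinuousLinearMap.inr ℝ X Y)) p := by
    intro p
    refine HasFDerivAt.comp (g := f) p (f.hasFDerivAt (z.1, p)) ?_
    refine ((hasFDerivAt_const z.1 p).prodMk (hasFDerivAt_id p)).congr_fderiv ?_
    ext v <;> simp
  have e2 : ∀ p : Y, (dot z.2 v • (Complex.exp (-(Complex.I * (dot z.2 p : ℝ))) * (-Complex.I))) •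
      f (z.1, p) = (-(Complex.I * ((dot z.2 v : ℝ) : ℂ))) •
        (Complex.exp (-(Complex.I * (dot z.2 p : ℝ))) • f (z.1, p)) := by
    intro p
    rw [smul_smul]
    congr 1
    rw [Complex.real_smul]
    ring
  have i2 : Integrable (fun p : Y =>
      (dot z.2 v • (Complex.exp (-(Complex.I * (dot z.2 p : ℝ))) * (-Complex.I))) •
        f (z.1, p)) := by
    simp only [e2]
    exact (osc_integrand_integrable f z).smul _
  have key := integral_bilinear_hasFDerivAt_right_eq_neg_left_of_integrable (μ := volume)
    (B := ContinuousLinearMap.lsmul ℝ ℂ (E := G)) (v := v) i2 i1 (osc_integrand_integrable f z)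
    (fun p _ => hE p) (fun p _ => hF p)
  refine (e1.trans key).trans ?_
  change -∫ p : Y, (dot z.2 v • (Complex.exp (-(Complex.I * (dot z.2 p : ℝ))) * (-Complex.I))) •
        f (z.1, p) = _
  simp only [e2]
  rw [integral_smul, neg_smul, neg_neg, ← smul_smul]
  rfl

theorem osc_norm_oscP (f : 𝓢(X × Y, G)) (z : X × Y) :
    ‖osc (oscP f) z‖ = ‖dot z.2‖ * ‖osc f z‖ := by
  have : osc (oscP f) z = (dot z.2).smulRight (Complex.I • osc f z) := by
    apply ContinuousLinearMap.ext
    intro v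
    rw [osc_oscP, ofReal_smul', smul_comm]
    rfl
  rw [this, ContinuousLinearMap.norm_smulRight_apply, norm_smul]
  simp

theorem exists_norm_le_dot : ∃ c : ℝ, 0 ≤ c ∧ ∀ y : Y, ‖y‖ ≤ c * ‖dot y‖ := by
  obtain ⟨K, _, hK⟩ := LinearMap.exists_antilipschitzWith (dot (Y := Y)).toLinearMap
    (LinearMap.ker_eq_bot'.mpr nondeg)
  refine ⟨K, K.2, fun y => ?_⟩
  simpa using hK.le_mul_dist y 0

theorem osc_bound (k l : ℕ) : ∀ (G : Type) [NormedAddCommGroup G] [NormedSpace ℝ G]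
    [NormedSpace ℂ G] [SMulCommClass ℝ ℂ G] [IsScalarTower ℝ ℂ G],
    ∃ q : Seminorm ℂ 𝓢(X × Y, G), Continuous q ∧
      ∀ (f : 𝓢(X × Y, G)) (z : X × Y), ‖z.1‖ ^ k * ‖z.2‖ ^ l * ‖osc f z‖ ≤ q f := by
  induction l with
  | zero =>
    intro G _ _ _ _ _
    obtain ⟨g, q, hg, hg0, hq, h⟩ := exists_bound (X := X) (Y := Y) (G := G) k
    let C : NNReal := ⟨∫ p, g p, integral_nonneg hg0⟩
    refine ⟨C • q, hq.const_smul _, fun f z => ?_⟩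
    rw [pow_zero, mul_one]
    change _ ≤ (∫ p, g p) * q f
    calc ‖z.1‖ ^ k * ‖osc f z‖
        ≤ ‖z.1‖ ^ k * ∫ p : Y, ‖f (z.1, p)‖ := by
          gcongr
          refine (norm_integral_le_integral_norm _).trans_eq ?_
          congr 1
          ext p
          rw [norm_smul, norm_exp_dot, one_mul]
      _ = ∫ p : Y, ‖z.1‖ ^ k * ‖f (z.1, p)‖ := (integral_const_mul _ _).symm
      _ ≤ ∫ p : Y, g p * q f := integral_mono ((osc_integrable f z.1).norm.const_mul _)
          (hg.mul_const _) (fun p => h f z.1 p)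
      _ = _ := integral_mul_const _ _
  | succ l ih =>
    intro G _ _ _ _ _
    obtain ⟨q, hq, h⟩ := ih (Y →L[ℝ] G)
    obtain ⟨c, hc, hc'⟩ := exists_norm_le_dot (Y := Y)
    let C : NNReal := ⟨c, hc⟩
    refine ⟨C • q.comp (oscP (X := X) (Y := Y) (G := G)).toLinearMap,
      (hq.comp (oscP (X := X) (Y := Y) (G := G)).continuous).const_smul _, fun f z => ?_⟩
    change _ ≤ c * q (oscP f)
    calc ‖z.1‖ ^ k * ‖z.2‖ ^ (l + 1) * ‖osc f z‖
        = ‖z.1‖ ^ k * ‖z.2‖ ^ l * (‖z.2‖ * ‖osc f z‖) := by ring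
      _ ≤ ‖z.1‖ ^ k * ‖z.2‖ ^ l * ((c * ‖dot z.2‖) * ‖osc f z‖) := by
          gcongr
          exact hc' _
      _ = c * (‖z.1‖ ^ k * ‖z.2‖ ^ l * ‖osc (oscP f) z‖) := by rw [osc_norm_oscP]; ring
      _ ≤ c * q (oscP f) := by
          gcongr
          exact h _ _

theorem osc_fderiv (f : 𝓢(X × Y, G)) : fderiv ℝ (osc f) = osc (oscD f) :=
  funext fun z => (osc_hasFDerivAt f z).fderiv

theorem osc_contDiff (m : ℕ) : ∀ (G : Type) [NormedAddCommGroup G] [NormedSpace ℝ G]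
    [NormedSpace ℂ G] [SMulCommClass ℝ ℂ G] [IsScalarTower ℝ ℂ G] (f : 𝓢(X × Y, G)),
    ContDiff ℝ m (osc f) := by
  induction m with
  | zero =>
    intro G _ _ _ _ _ f
    exact contDiff_zero.mpr (continuous_iff_continuousAt.mpr
      fun z => (osc_hasFDerivAt f z).continuousAt)
  | succ m ih =>
    intro G _ _ _ _ _ f
    rw [Nat.cast_succ, contDiff_succ_iff_fderiv]
    refine ⟨fun z => (osc_hasFDerivAt f z).differentiableAt, fun h => ?_, ?_⟩
    · exact absurd h (by exact_mod_cast WithTop.coe_ne_top)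
    · rw [osc_fderiv]
      exact ih _ _

theorem osc_decay (k m : ℕ) : ∀ (G : Type) [NormedAddCommGroup G] [NormedSpace ℝ G]
    [NormedSpace ℂ G] [SMulCommClass ℝ ℂ G] [IsScalarTower ℝ ℂ G],
    ∃ q : Seminorm ℂ 𝓢(X × Y, G), Continuous q ∧
      ∀ (f : 𝓢(X × Y, G)) (z : X × Y), ‖z‖ ^ k * ‖iteratedFDeriv ℝ m (osc f) z‖ ≤ q f := by
  induction m with
  | zero =>
    intro G _ _ _ _ _
    obtain ⟨q₁, hq₁, h₁⟩ := osc_bound (X := X) (Y := Y) k 0 G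
    obtain ⟨q₂, hq₂, h₂⟩ := osc_bound (X := X) (Y := Y) 0 k G
    refine ⟨q₁ + q₂, hq₁.add hq₂, fun f z => ?_⟩
    have h₁' := h₁ f z
    have h₂' := h₂ f z
    rw [pow_zero, mul_one] at h₁'
    rw [pow_zero, one_mul] at h₂'
    have p₁ : 0 ≤ q₁ f := apply_nonneg _ _
    have p₂ : 0 ≤ q₂ f := apply_nonneg _ _
    rw [norm_iteratedFDeriv_zero]
    change _ ≤ q₁ f + q₂ f
    rcases max_choice ‖z.1‖ ‖z.2‖ with h | h
    · rw [Prod.norm_def, h]; linarith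
    · rw [Prod.norm_def, h]; linarith
  | succ m ih =>
    intro G _ _ _ _ _
    obtain ⟨q, hq, h⟩ := ih (X × Y →L[ℝ] G)
    refine ⟨q.comp (oscD (X := X) (Y := Y) (G := G)).toLinearMap,
      hq.comp (oscD (X := X) (Y := Y) (G := G)).continuous, fun f z => ?_⟩
    rw [← norm_iteratedFDeriv_fderiv, osc_fderiv]
    exact h _ _

/-- The unitary partial Fourier transform in the second variable on Schwartz functions,
`(x, ξ) ↦ (2π)^{-d/2} ∫ e^{-i ξ·p} Ψ(x, p) dp` with `d = dim Y`. -/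
noncomputable def partialFourier : 𝓢(X × Y, ℂ) →L[ℂ] 𝓢(X × Y, ℂ) :=
  (((2 * Real.pi) ^ (-(Module.finrank ℝ Y : ℝ) / 2) : ℝ) : ℂ) •
  mkCLM (fun (Ψ : 𝓢(X × Y, ℂ)) (z : X × Y) =>
      ∫ p : Y, Complex.exp (-(Complex.I * (dot z.2 p : ℝ))) * Ψ (z.1, p))
    (fun f g z => by
      simp only [add_apply, mul_add]
      exact integral_add (osc_integrand_integrable f z) (osc_integrand_integrable g z))
    (fun c f z => by
      simp only [smul_apply, smul_eq_mul, mul_left_comm _ c, RingHom.id_apply]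
      exact integral_const_mul _ _)
    (fun f => contDiff_infty.mpr fun m => osc_contDiff m ℂ f)
    (fun n => by
      obtain ⟨q, hq, h⟩ := osc_decay (X := X) (Y := Y) n.1 n.2 ℂ
      obtain ⟨s, C, -, hC⟩ := Seminorm.bound_of_continuous (schwartz_withSeminorms ℂ (X × Y) ℂ) q hq
      exact ⟨s, C, C.2, fun f z => (h f z).trans (hC f)⟩)

theorem partialFourier_apply (Ψ : 𝓢(X × Y, ℂ)) (x : X) (ξ : Y) :
    partialFourier Ψ (x, ξ) = (((2 * Real.pi) ^ (-(Module.finrank ℝ Y : ℝ) / 2) : ℝ) : ℂ) *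
      ∫ p : Y, Complex.exp (-(Complex.I * (dot ξ p : ℝ))) * Ψ (x, p) :=
  rfl

/-- The reflection `(x, p) ↦ (x, -p)`. -/
noncomputable def reflectSnd (X Y : Type) [NormedAddCommGroup X] [NormedSpace ℝ X]
    [NormedAddCommGroup Y] [NormedSpace ℝ Y] : (X × Y) ≃L[ℝ] (X × Y) :=
  (ContinuousLinearEquiv.refl ℝ X).prodCongr (ContinuousLinearEquiv.neg ℝ)

/-- The inverse partial Fourier transform in the second variable on Schwartz functions. -/
noncomputable def partialFourierInv : 𝓢(X × Y, ℂ) →L[ℂ] 𝓢(X × Y, ℂ) :=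
  compCLMOfContinuousLinearEquiv ℂ (reflectSnd X Y) ∘L partialFourier

theorem partialFourierInv_apply (Φ : 𝓢(X × Y, ℂ)) (x : X) (p : Y) :
    partialFourierInv Φ (x, p) = (((2 * Real.pi) ^ (-(Module.finrank ℝ Y : ℝ) / 2) : ℝ) : ℂ) *
      ∫ ξ : Y, Complex.exp (Complex.I * (dot p ξ : ℝ)) * Φ (x, ξ) := by
  change partialFourier Φ (x, -p) = _
  rw [partialFourier_apply]
  simp

/-- Integration over the second variable, `x ↦ ∫ f(x, y) dy`. -/
noncomputable def partialIntegral : 𝓢(X × Y, ℂ) →L[ℂ] 𝓢(X, ℂ) :=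
  (((2 * Real.pi) ^ ((Module.finrank ℝ Y : ℝ) / 2) : ℝ) : ℂ) •
    (compCLMOfAntilipschitz ℂ (K := 1) (ContinuousLinearMap.inl ℝ X Y).hasTemperateGrowth
      (by
        refine AntilipschitzWith.of_le_mul_dist fun x y => ?_
        simp [dist_eq_norm, Prod.norm_def]) ∘L partialFourier)

theorem partialIntegral_apply (f : 𝓢(X × Y, ℂ)) (x : X) :
    partialIntegral f x = ∫ y : Y, f (x, y) := by
  change (((2 * Real.pi) ^ ((Module.finrank ℝ Y : ℝ) / 2) : ℝ) : ℂ) *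
    partialFourier f (x, 0) = _
  have hc : (((2 * Real.pi) ^ ((Module.finrank ℝ Y : ℝ) / 2) : ℝ) : ℂ) *
      (((2 * Real.pi) ^ (-(Module.finrank ℝ Y : ℝ) / 2) : ℝ) : ℂ) = 1 := by
    rw [← Complex.ofReal_mul, ← Real.rpow_add (by positivity), neg_div, add_neg_cancel,
      Real.rpow_zero, Complex.ofReal_one]
  rw [partialFourier_apply, ← mul_assoc, hc, one_mul]
  simp

end Transform

section Tensor

variable {X Y : Type} [NormedAddCommGroup X] [NormedSpace ℝ X] [NormedAddCommGroup Y]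
  [NormedSpace ℝ Y]

theorem norm_iteratedFDeriv_comp_le_one {V W : Type} [NormedAddCommGroup V] [NormedSpace ℝ V]
    [NormedAddCommGroup W] [NormedSpace ℝ W] (L : V →L[ℝ] W) (hL : ‖L‖ ≤ 1) (f : 𝓢(W, ℂ)) (i : ℕ)
    (z : V) : ‖iteratedFDeriv ℝ i (fun v => f (L v)) z‖ ≤ ‖iteratedFDeriv ℝ i f (L z)‖ := by
  have h := L.iteratedFDeriv_comp_right (f.smooth ⊤) z (i := i) (mod_cast le_top)
  change iteratedFDeriv ℝ i (fun v => f (L v)) z = _ at h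
  rw [h]
  refine (ContinuousMultilinearMap.norm_compContinuousLinearMap_le _ _).trans ?_
  refine mul_le_of_le_one_right (norm_nonneg _) ?_
  exact Finset.prod_le_one (fun _ _ => norm_nonneg _) (fun _ _ => hL)

theorem tensor_bound (f : 𝓢(X, ℂ)) (k m : ℕ) : ∃ (s : Finset (ℕ × ℕ)) (C : ℝ), 0 ≤ C ∧
    ∀ (g : 𝓢(Y, ℂ)) (z : X × Y),
      ‖z‖ ^ k * ‖iteratedFDeriv ℝ m (fun z : X × Y => f z.1 * g z.2) z‖ ≤
        C * s.sup (schwartzSeminormFamily ℂ Y ℂ) g := by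
  refine ⟨Finset.Iic (k, m), ∑ i ∈ Finset.range (m + 1), (m.choose i : ℝ) *
    (SchwartzMap.seminorm ℂ k i f + SchwartzMap.seminorm ℂ 0 i f),
    Finset.sum_nonneg fun i _ => mul_nonneg (Nat.cast_nonneg _)
      (add_nonneg (apply_nonneg _ _) (apply_nonneg _ _)), fun g z => ?_⟩
  have hs : ∀ j i : ℕ, j ≤ k → i ≤ m → SchwartzMap.seminorm ℂ j i g ≤
      (Finset.Iic (k, m)).sup (schwartzSeminormFamily ℂ Y ℂ) g := fun j i hj hi =>
    Seminorm.le_def.mp (Finset.le_sup (f := schwartzSeminormFamily ℂ Y ℂ) (b := (j, i))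
      (Finset.mem_Iic.mpr (Prod.mk_le_mk.mpr ⟨hj, hi⟩))) g
  have h1 := norm_iteratedFDeriv_mul_le (𝕜 := ℝ) (N := ∞)
    (f := fun z : X × Y => f z.1) (g := fun z : X × Y => g z.2)
    ((f.smooth ⊤).comp contDiff_fst) ((g.smooth ⊤).comp contDiff_snd) z (n := m)
    (mod_cast le_top)
  refine (mul_le_mul_of_nonneg_left h1 (by positivity)).trans ?_
  rw [Finset.mul_sum, Finset.sum_mul]
  refine Finset.sum_le_sum fun i hi => ?_
  have hf := norm_iteratedFDeriv_comp_le_one (ContinuousLinearMap.fst ℝ X Y)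
    (ContinuousLinearMap.norm_fst_le _ _ _) f i z
  have hg := norm_iteratedFDeriv_comp_le_one (ContinuousLinearMap.snd ℝ X Y)
    (ContinuousLinearMap.norm_snd_le _ _ _) g (m - i) z
  change ‖iteratedFDeriv ℝ i (fun z : X × Y => f z.1) z‖ ≤ ‖iteratedFDeriv ℝ i f z.1‖ at hf
  change ‖iteratedFDeriv ℝ (m - i) (fun z : X × Y => g z.2) z‖ ≤
    ‖iteratedFDeriv ℝ (m - i) g z.2‖ at hg
  set Q := (Finset.Iic (k, m)).sup (schwartzSeminormFamily ℂ Y ℂ) g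
  have a1 := le_seminorm ℂ k i f z.1
  have a2 := norm_iteratedFDeriv_le_seminorm ℂ f i z.1
  have b1 := (le_seminorm ℂ k (m - i) g z.2).trans (hs k (m - i) le_rfl (Nat.sub_le _ _))
  have b2 := (norm_iteratedFDeriv_le_seminorm ℂ g (m - i) z.2).trans
    (hs 0 (m - i) (Nat.zero_le _) (Nat.sub_le _ _))
  have hQ : 0 ≤ Q := apply_nonneg _ _
  have p1 : 0 ≤ SchwartzMap.seminorm ℂ k i f := apply_nonneg _ _
  have p2 : 0 ≤ SchwartzMap.seminorm ℂ 0 i f := apply_nonneg _ _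
  have hz : ‖z‖ ^ k ≤ ‖z.1‖ ^ k + ‖z.2‖ ^ k := by
    rw [Prod.norm_def]
    rcases max_choice ‖z.1‖ ‖z.2‖ with h | h <;> rw [h] <;> simp
  calc ‖z‖ ^ k * ((m.choose i : ℝ) * ‖iteratedFDeriv ℝ i (fun z : X × Y => f z.1) z‖ *
          ‖iteratedFDeriv ℝ (m - i) (fun z : X × Y => g z.2) z‖)
      ≤ (‖z.1‖ ^ k + ‖z.2‖ ^ k) * ((m.choose i : ℝ) * ‖iteratedFDeriv ℝ i f z.1‖ *
          ‖iteratedFDeriv ℝ (m - i) g z.2‖) := by gcongr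
    _ = (m.choose i : ℝ) * ((‖z.1‖ ^ k * ‖iteratedFDeriv ℝ i f z.1‖) *
          ‖iteratedFDeriv ℝ (m - i) g z.2‖ + ‖iteratedFDeriv ℝ i f z.1‖ *
          (‖z.2‖ ^ k * ‖iteratedFDeriv ℝ (m - i) g z.2‖)) := by ring
    _ ≤ (m.choose i : ℝ) * (SchwartzMap.seminorm ℂ k i f * Q +
          SchwartzMap.seminorm ℂ 0 i f * Q) := by gcongr
    _ = _ := by ring

/-- The tensor product `(f ⊗ g)(x, y) = f(x) g(y)`, as a continuous linear function of `g`. -/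
noncomputable def tensor (f : 𝓢(X, ℂ)) : 𝓢(Y, ℂ) →L[ℂ] 𝓢(X × Y, ℂ) :=
  mkCLM (fun (g : 𝓢(Y, ℂ)) (z : X × Y) => f z.1 * g z.2)
    (fun g h z => by simp only [add_apply, mul_add])
    (fun c g z => by simp only [smul_apply, smul_eq_mul, mul_left_comm _ c, RingHom.id_apply])
    (fun g => ((f.smooth ⊤).comp contDiff_fst).mul ((g.smooth ⊤).comp contDiff_snd))
    (fun n => tensor_bound f n.1 n.2)

theorem tensor_apply (f : 𝓢(X, ℂ)) (g : 𝓢(Y, ℂ)) (x : X) (y : Y) :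
    tensor f g (x, y) = f x * g y := rfl

theorem continuous_tensor_left (g : 𝓢(Y, ℂ)) :
    Continuous fun f : 𝓢(X, ℂ) => tensor f g := by
  have : (fun f : 𝓢(X, ℂ) => tensor f g) = fun f =>
      compCLMOfContinuousLinearEquiv ℂ (ContinuousLinearEquiv.prodComm ℝ X Y) (tensor g f) := by
    ext f z
    exact mul_comm _ _
  rw [this]
  exact (compCLMOfContinuousLinearEquiv ℂ (ContinuousLinearEquiv.prodComm ℝ X Y)).continuous.comp
    (tensor g).continuous

/-- The tensor product as a continuous linear function of `f`. -/
noncomputable def tensorRight (g : 𝓢(Y, ℂ)) : 𝓢(X, ℂ) →L[ℂ] 𝓢(X × Y, ℂ) where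
  toFun f := tensor f g
  map_add' f h := by
    ext z
    exact add_mul _ _ _
  map_smul' c f := by
    ext z
    exact mul_assoc _ _ _
  cont := continuous_tensor_left g

theorem tensorRight_apply (f : 𝓢(X, ℂ)) (g : 𝓢(Y, ℂ)) : tensorRight g f = tensor f g := rfl

end Tensor

/-- The Euclidean space `ℝⁿ`. -/
abbrev Vec (n : ℕ) : Type := EuclideanSpace ℝ (Fin n)

section Euclidean

variable {n : ℕ}

theorem partialFourierInv_partialFourier (Ψ : 𝓢(Vec n × Vec n, ℂ)) :
    partialFourierInv (partialFourier Ψ) = Ψ := by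
  ext ⟨x, p⟩
  have hup : ∀ p : Vec n, ‖p‖ ≤ 1 * (1 + ‖((x, p) : Vec n × Vec n)‖) ^ 1 := fun p => by
    have := norm_snd_le (x, p)
    simp only [one_mul, pow_one]
    linarith
  have htg : (fun p : Vec n => ((x, p) : Vec n × Vec n)).HasTemperateGrowth := by
    have h := (Function.HasTemperateGrowth.const (E := Vec n) (x, (0 : Vec n))).add
      (ContinuousLinearMap.inr ℝ (Vec n) (Vec n)).hasTemperateGrowth
    have e : ((fun _ : Vec n => (x, (0 : Vec n))) + ⇑(ContinuousLinearMap.inr ℝ (Vec n) (Vec n))) =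
        fun p : Vec n => ((x, p) : Vec n × Vec n) := by
      ext1 p
      simp
    rwa [e] at h
  let g : 𝓢(Vec n, ℂ) := compCLM ℂ htg ⟨1, 1, hup⟩ Ψ
  have hg : ∀ p, g p = Ψ (x, p) := fun _ => rfl
  set c : ℂ := (((2 * Real.pi) ^ (-(Module.finrank ℝ (Vec n) : ℝ) / 2) : ℝ) : ℂ) with hc
  have h1 : ∀ ξ : Vec n, partialFourier Ψ (x, ξ) =
      c * FourierTransform.fourier (g : Vec n → ℂ) ((2 * Real.pi)⁻¹ • ξ) := by
    intro ξ
    rw [partialFourier_apply, Real.fourier_eq']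
    congr 2
    ext v
    rw [smul_eq_mul, hg]
    congr 2
    change -(Complex.I * ((inner ℝ ξ v : ℝ) : ℂ)) = _
    rw [inner_smul_right, real_inner_comm ξ v]
    have : -2 * Real.pi * ((2 * Real.pi)⁻¹ * inner ℝ ξ v) = - inner ℝ ξ v := by
      field_simp
    rw [this]
    push_cast
    ring
  have h2 : ∀ ξ : Vec n, Complex.exp (Complex.I * (dot p ξ : ℝ)) * partialFourier Ψ (x, ξ) =
      c * (fun η : Vec n => Complex.exp (((2 * Real.pi * inner ℝ η p : ℝ) : ℂ) * Complex.I) •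
        FourierTransform.fourier (g : Vec n → ℂ) η) ((2 * Real.pi)⁻¹ • ξ) := by
    intro ξ
    rw [h1]
    simp only [smul_eq_mul]
    rw [mul_left_comm]
    congr 3
    change Complex.I * ((inner ℝ p ξ : ℝ) : ℂ) = _
    rw [inner_smul_left, real_inner_comm ξ p]
    have : 2 * Real.pi * ((starRingEnd ℝ) (2 * Real.pi)⁻¹ * inner ℝ ξ p) = inner ℝ ξ p := by
      simp only [conj_trivial]
      field_simp
    rw [this, mul_comm]
  rw [partialFourierInv_apply]
  simp only [h2]
  rw [integral_const_mul, Measure.integral_comp_smul volume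
    (fun η : Vec n => Complex.exp (((2 * Real.pi * inner ℝ η p : ℝ) : ℂ) * Complex.I) •
        FourierTransform.fourier (g : Vec n → ℂ) η), ← Real.fourierInv_eq',
    g.continuous.fourierInv_fourier_eq g.integrable (FourierTransform.fourier g).integrable, hg,
    ← hc, ← mul_assoc, Complex.real_smul, ← mul_assoc]
  have : c * c * ((|((2 * Real.pi)⁻¹ ^ Module.finrank ℝ (Vec n))⁻¹| : ℝ) : ℂ) = 1 := by
    rw [hc, ← Complex.ofReal_mul, ← Complex.ofReal_mul, ← Real.rpow_add (by positivity),
      inv_pow, inv_inv, abs_of_pos (by positivity), ← Real.rpow_natCast,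
      ← Real.rpow_add (by positivity)]
    have : -(Module.finrank ℝ (Vec n) : ℝ) / 2 + -(Module.finrank ℝ (Vec n) : ℝ) / 2 +
      (Module.finrank ℝ (Vec n) : ℝ) = 0 := by ring
    rw [this, Real.rpow_zero, Complex.ofReal_one]
  rw [this, one_mul]

theorem partialFourier_reflect (Ψ : 𝓢(Vec n × Vec n, ℂ)) :
    partialFourier (compCLMOfContinuousLinearEquiv ℂ (reflectSnd (Vec n) (Vec n)) Ψ) =
      compCLMOfContinuousLinearEquiv ℂ (reflectSnd (Vec n) (Vec n)) (partialFourier Ψ) := by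
  ext ⟨x, ξ⟩
  change _ = partialFourier Ψ (x, -ξ)
  rw [partialFourier_apply, partialFourier_apply]
  congr 1
  rw [← integral_neg_eq_self]
  congr 1
  ext p
  simp [reflectSnd]

theorem partialFourier_partialFourierInv (Ψ : 𝓢(Vec n × Vec n, ℂ)) :
    partialFourier (partialFourierInv Ψ) = Ψ := by
  have h := partialFourierInv_partialFourier Ψ
  unfold partialFourierInv at h ⊢
  rw [ContinuousLinearMap.comp_apply] at h ⊢
  rw [partialFourier_reflect]
  exact h

/-- The frequency `k = √7` of the Hamiltonian flow. -/
noncomputable def freq : ℝ := Real.sqrt 7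

/-- The time `θ₀ = (√7/7) arccos (3/4)`. -/
noncomputable def theta0 : ℝ := Real.sqrt 7 / 7 * Real.arccos (3 / 4)

theorem freq_sq : freq ^ 2 = 7 := Real.sq_sqrt (by norm_num)

theorem freq_ne : freq ≠ 0 := by
  intro h
  have := freq_sq
  rw [h] at this
  norm_num at this

/-- The component in the `(x, ξ_p)` variables of the flow of
`H = 2 ξ_x·ξ_p - x·ξ_x - p·ξ_p + 4 x·p`, as a linear map:
`x(θ) = x (cos kθ - k⁻¹ sin kθ) + 2 k⁻¹ ξ_p sin kθ`,
`ξ_p(θ) = ξ_p (cos kθ + k⁻¹ sin kθ) - 4 k⁻¹ x sin kθ`. -/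
noncomputable def flowMap (n : ℕ) (θ : ℝ) : (Vec n × Vec n) →L[ℝ] (Vec n × Vec n) :=
  ((Real.cos (freq * θ) - freq⁻¹ * Real.sin (freq * θ)) • ContinuousLinearMap.fst ℝ (Vec n) (Vec n) +
    (2 * freq⁻¹ * Real.sin (freq * θ)) • ContinuousLinearMap.snd ℝ (Vec n) (Vec n)).prod
  ((Real.cos (freq * θ) + freq⁻¹ * Real.sin (freq * θ)) • ContinuousLinearMap.snd ℝ (Vec n) (Vec n) -
    (4 * freq⁻¹ * Real.sin (freq * θ)) • ContinuousLinearMap.fst ℝ (Vec n) (Vec n))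

theorem flowMap_apply (θ : ℝ) (x ξ : Vec n) : flowMap n θ (x, ξ) =
    ((Real.cos (freq * θ) - freq⁻¹ * Real.sin (freq * θ)) • x +
      (2 * freq⁻¹ * Real.sin (freq * θ)) • ξ,
     (Real.cos (freq * θ) + freq⁻¹ * Real.sin (freq * θ)) • ξ -
      (4 * freq⁻¹ * Real.sin (freq * θ)) • x) := rfl

theorem flowMap_neg_flowMap (θ : ℝ) (z : Vec n × Vec n) : flowMap n (-θ) (flowMap n θ z) = z := by
  obtain ⟨x, ξ⟩ := z
  have h := Real.sin_sq_add_cos_sq (freq * θ)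
  have hk : freq⁻¹ ^ 2 * 7 = 1 := by rw [inv_pow, freq_sq]; norm_num
  rw [flowMap_apply, flowMap_apply, mul_neg, Real.cos_neg, Real.sin_neg]
  generalize Real.cos (freq * θ) = c at h ⊢
  generalize Real.sin (freq * θ) = s at h ⊢
  generalize freq⁻¹ = r at hk ⊢
  refine Prod.ext ?_ ?_
  · match_scalars <;> first | ring1 | linear_combination h + s ^ 2 * hk
  · match_scalars <;> first | ring1 | linear_combination h + s ^ 2 * hk

/-- The flow at time `θ` as a linear equivalence. -/
noncomputable def flow (n : ℕ) (θ : ℝ) : (Vec n × Vec n) ≃L[ℝ] (Vec n × Vec n) :=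
  ContinuousLinearEquiv.equivOfInverse (flowMap n θ) (flowMap n (-θ)) (flowMap_neg_flowMap θ)
    (fun z => by simpa using flowMap_neg_flowMap (-θ) z)

/-- `(T(θ) Φ)(x, ξ_p) = Φ(x(-θ), ξ_p(-θ))`. -/
noncomputable def transport (n : ℕ) (θ : ℝ) : 𝓢(Vec n × Vec n, ℂ) →L[ℂ] 𝓢(Vec n × Vec n, ℂ) :=
  compCLMOfContinuousLinearEquiv ℂ (flow n (-θ))

theorem transport_neg_transport (θ : ℝ) (Φ : 𝓢(Vec n × Vec n, ℂ)) :
    transport n (-θ) (transport n θ Φ) = Φ := by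
  ext z
  change Φ (flowMap n (-θ) (flowMap n (- -θ) z)) = Φ z
  rw [neg_neg, flowMap_neg_flowMap]

/-- The metaplectic operator `U(θ) = F⁻¹ T(θ) F` on Schwartz functions of `(x, p)`, where `F` is the
partial Fourier transform `p → ξ_p`, with its inverse `F⁻¹ T(-θ) F`. -/
noncomputable def metaplectic (n : ℕ) (θ : ℝ) : 𝓢(Vec n × Vec n, ℂ) ≃L[ℂ] 𝓢(Vec n × Vec n, ℂ) :=
  ContinuousLinearEquiv.equivOfInverse
    (partialFourierInv ∘L transport n θ ∘L partialFourier)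
    (partialFourierInv ∘L transport n (-θ) ∘L partialFourier)
    (fun Ψ => by
      simp only [ContinuousLinearMap.comp_apply, partialFourier_partialFourierInv,
        transport_neg_transport, partialFourierInv_partialFourier])
    (fun Ψ => by
      have h := transport_neg_transport (-θ) (partialFourier Ψ)
      rw [neg_neg] at h
      simp only [ContinuousLinearMap.comp_apply, partialFourier_partialFourierInv,
        h, partialFourierInv_partialFourier])

end Euclidean

section Distributions

variable {X Y : Type} [NormedAddCommGroup X] [NormedSpace ℝ X] [NormedAddCommGroup Y]
  [NormedSpace ℝ Y]

/-- The transpose of an operator on test functions, acting on tempered distributions: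
`⟨Lᵗ u, φ⟩ = ⟨u, L φ⟩`. -/
noncomputable def transpose (L : 𝓢(X, ℂ) →L[ℂ] 𝓢(Y, ℂ)) : 𝓢'(Y, ℂ) →L[ℂ] 𝓢'(X, ℂ) :=
  PointwiseConvergenceCLM.precomp ℂ L

theorem transpose_apply (L : 𝓢(X, ℂ) →L[ℂ] 𝓢(Y, ℂ)) (u : 𝓢'(Y, ℂ)) (φ : 𝓢(X, ℂ)) :
    transpose L u φ = u (L φ) := rfl

/-- The composition `u ∘ M` of a tempered distribution with an invertible linear map:
`⟨u ∘ M, φ⟩ = |det M|⁻¹ ⟨u, φ ∘ M⁻¹⟩`. -/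
noncomputable def pullback (M : X ≃L[ℝ] X) : 𝓢'(X, ℂ) →L[ℂ] 𝓢'(X, ℂ) :=
  ((|(M : X →L[ℝ] X).det|⁻¹ : ℝ) : ℂ) • transpose (compCLMOfContinuousLinearEquiv ℂ M.symm)

/-- The operator `𝓢 → 𝓢'` with distribution kernel `K`: `⟨T ψ, φ⟩ = ⟨K(x, y), φ(x) ψ(y)⟩`. -/
noncomputable def kernelOp (K : 𝓢'(X × X, ℂ)) : 𝓢(X, ℂ) →L[ℂ] 𝓢'(X, ℂ) where
  toFun ψ := transpose (tensorRight ψ) K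
  map_add' ψ₁ ψ₂ := by
    ext φ
    change K (tensor φ (ψ₁ + ψ₂)) = K (tensor φ ψ₁) + K (tensor φ ψ₂)
    rw [map_add, map_add]
  map_smul' c ψ := by
    ext φ
    change K (tensor φ (c • ψ)) = c • K (tensor φ ψ)
    rw [map_smul, map_smul]
  cont := PointwiseConvergenceCLM.continuous_of_continuous_eval fun φ =>
    K.continuous.comp (tensor φ).continuous

theorem kernelOp_apply (K : 𝓢'(X × X, ℂ)) (ψ φ : 𝓢(X, ℂ)) :
    kernelOp K ψ φ = K (tensor φ ψ) := rfl

/-- The tensor product `a ⊗ 1`, that is `(x, y) ↦ a(x)`: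
`⟨a ⊗ 1, φ⟩ = ⟨a, ∫ φ(·, y) dy⟩`. -/
noncomputable def tensorOne (X Y : Type) [NormedAddCommGroup X] [NormedSpace ℝ X]
    [NormedAddCommGroup Y] [NormedSpace ℝ Y] [DotProduct Y] [FiniteDimensional ℝ Y]
    [MeasureSpace Y] [BorelSpace Y] [(volume : Measure Y).IsAddHaarMeasure] :
    𝓢'(X, ℂ) →L[ℂ] 𝓢'(X × Y, ℂ) :=
  transpose partialIntegral

end Distributions

section Weyl

variable (X : Type) [NormedAddCommGroup X] [NormedSpace ℝ X]

/-- The map `(x, y) ↦ (x + y/2, x - y/2)`. -/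
noncomputable def weylMap : (X × X) ≃L[ℝ] (X × X) :=
  ContinuousLinearEquiv.equivOfInverse
    ((ContinuousLinearMap.fst ℝ X X + (1 / 2 : ℝ) • ContinuousLinearMap.snd ℝ X X).prod
      (ContinuousLinearMap.fst ℝ X X - (1 / 2 : ℝ) • ContinuousLinearMap.snd ℝ X X))
    (((1 / 2 : ℝ) • ContinuousLinearMap.fst ℝ X X + (1 / 2 : ℝ) • ContinuousLinearMap.snd ℝ X X).prod
      (ContinuousLinearMap.fst ℝ X X - ContinuousLinearMap.snd ℝ X X))
    (fun z => by
      refine Prod.ext ?_ ?_ <;> simp <;> module)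
    (fun z => by
      refine Prod.ext ?_ ?_ <;> simp <;> module)

theorem weylMap_apply (x y : X) :
    weylMap X (x, y) = (x + (1 / 2 : ℝ) • y, x - (1 / 2 : ℝ) • y) := rfl

theorem weylMap_symm_apply (x y : X) :
    (weylMap X).symm (x, y) = ((1 / 2 : ℝ) • x + (1 / 2 : ℝ) • y, x - y) := rfl

variable [DotProduct X] [FiniteDimensional ℝ X] [MeasureSpace X] [BorelSpace X]
  [(volume : Measure X).IsAddHaarMeasure]

/-- The Weyl symbol of the operator with kernel `K`:
`a(x, p) = ∫ e^{-i p·y} K(x + y/2, x - y/2) dy` in the sense of distributions. -/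
noncomputable def weylSymbol (K : 𝓢'(X × X, ℂ)) : 𝓢'(X × X, ℂ) :=
  (((2 * Real.pi) ^ ((Module.finrank ℝ X : ℝ) / 2) : ℝ) : ℂ) •
    transpose partialFourier (pullback (weylMap X) K)

/-- The kernel of the operator with Weyl symbol `a`:
`K(x, x') = (2π)^{-d} ∫ e^{i (x - x')·ξ} a((x + x')/2, ξ) dξ` in the sense of distributions. -/
noncomputable def weylKernel (a : 𝓢'(X × X, ℂ)) : 𝓢'(X × X, ℂ) :=
  (((2 * Real.pi) ^ (-(Module.finrank ℝ X : ℝ) / 2) : ℝ) : ℂ) •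
    pullback (weylMap X).symm (transpose partialFourierInv a)

/-- `A` is the Weyl symbol of the operator `T : 𝓢 → 𝓢'`. -/
def IsWeylSymbol (T : 𝓢(X, ℂ) →L[ℂ] 𝓢'(X, ℂ)) (A : 𝓢'(X × X, ℂ)) : Prop :=
  ∃ K : 𝓢'(X × X, ℂ), T = kernelOp K ∧ A = weylSymbol X K

end Weyl

section BoppOperators

variable (n : ℕ)

/-- The map `((x, x'), p) ↦ ((x, p), (x', p))`. -/
noncomputable def diagMap :
    ((Vec n × Vec n) × Vec n) →L[ℝ] ((Vec n × Vec n) × (Vec n × Vec n)) :=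
  (((ContinuousLinearMap.fst ℝ _ _).comp (ContinuousLinearMap.fst ℝ _ _)).prod
    (ContinuousLinearMap.snd ℝ _ _)).prod
  (((ContinuousLinearMap.snd ℝ _ _).comp (ContinuousLinearMap.fst ℝ _ _)).prod
    (ContinuousLinearMap.snd ℝ _ _))

theorem diagMap_antilipschitz : AntilipschitzWith 1 (diagMap n) := by
  refine AntilipschitzWith.of_le_mul_dist fun z w => ?_
  rw [dist_eq_norm, dist_eq_norm, ← map_sub]
  generalize z - w = v
  obtain ⟨⟨x, x'⟩, p⟩ := v
  change ‖((x, x'), p)‖ ≤ 1 * ‖((x, p), (x', p))‖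
  simp only [Prod.norm_def, one_mul]
  refine max_le (max_le ?_ ?_) ?_ <;> simp

/-- `F ↦ ((x, x') ↦ ∫ F((x, p), (x', p)) dp)` on Schwartz functions. -/
noncomputable def contract :
    𝓢((Vec n × Vec n) × (Vec n × Vec n), ℂ) →L[ℂ] 𝓢(Vec n × Vec n, ℂ) :=
  partialIntegral ∘L compCLMOfAntilipschitz ℂ (diagMap n).hasTemperateGrowth
    (diagMap_antilipschitz n)

theorem contract_apply (F : 𝓢((Vec n × Vec n) × (Vec n × Vec n), ℂ)) (x x' : Vec n) :
    contract n F (x, x') = ∫ p : Vec n, F ((x, p), (x', p)) :=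
  partialIntegral_apply _ _

/-- The phase-space extension `A` of the Weyl operator with symbol `a`, acting on functions of
`(x, p)` through the variable `x` only:
`A Ψ(x, p) = (2π)^{-n} ∫ e^{i (x - x')·ξ_x} a((x + x')/2, ξ_x) Ψ(x', p) dx' dξ_x`. In the sense of
distributions `⟨A Ψ, Χ⟩ = ⟨K_a(x, x'), ∫ Χ(x, p) Ψ(x', p) dp⟩`, where `K_a` is the kernel of the
Weyl operator with symbol `a`. -/
noncomputable def phaseSpaceExt (a : 𝓢'(Vec n × Vec n, ℂ)) :
    𝓢(Vec n × Vec n, ℂ) →L[ℂ] 𝓢'(Vec n × Vec n, ℂ) :=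
  kernelOp (transpose (contract n) (weylKernel (Vec n) a))

/-- The extension of `U(θ) = F⁻¹ T(θ) F` to tempered distributions, by extending each factor. -/
noncomputable def metaplecticDist (θ : ℝ) : 𝓢'(Vec n × Vec n, ℂ) →L[ℂ] 𝓢'(Vec n × Vec n, ℂ) :=
  transpose partialFourierInv ∘L pullback (flow n (-θ)) ∘L transpose partialFourier

/-- The Bopp operator `A_B = S A S⁻¹` with `S = U(θ₀)`. -/
noncomputable def boppOp (a : 𝓢'(Vec n × Vec n, ℂ)) :
    𝓢(Vec n × Vec n, ℂ) →L[ℂ] 𝓢'(Vec n × Vec n, ℂ) :=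
  metaplecticDist n theta0 ∘L phaseSpaceExt n a ∘L
    ((metaplectic n theta0).symm : 𝓢(Vec n × Vec n, ℂ) →L[ℂ] 𝓢(Vec n × Vec n, ℂ))

/-- The map `((x, p), (ξ_x, ξ_p)) ↦ ((x - ξ_p/2, p + ξ_x/2), (ξ_x, ξ_p))`. -/
noncomputable def boppMap :
    ((Vec n × Vec n) × (Vec n × Vec n)) ≃L[ℝ] ((Vec n × Vec n) × (Vec n × Vec n)) :=
  let J : (Vec n × Vec n) →L[ℝ] (Vec n × Vec n) :=
    (-(1 / 2 : ℝ) • ContinuousLinearMap.snd ℝ (Vec n) (Vec n)).prod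
      ((1 / 2 : ℝ) • ContinuousLinearMap.fst ℝ (Vec n) (Vec n))
  let pos := ContinuousLinearMap.fst ℝ (Vec n × Vec n) (Vec n × Vec n)
  let mom := ContinuousLinearMap.snd ℝ (Vec n × Vec n) (Vec n × Vec n)
  ContinuousLinearEquiv.equivOfInverse ((pos + J.comp mom).prod mom) ((pos - J.comp mom).prod mom)
    (fun z => by
      refine Prod.ext ?_ ?_ <;> simp [pos, mom])
    (fun z => by
      refine Prod.ext ?_ ?_ <;> simp [pos, mom])

theorem boppMap_apply (x p ξ η : Vec n) : boppMap n ((x, p), (ξ, η)) =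
    ((x - (1 / 2 : ℝ) • η, p + (1 / 2 : ℝ) • ξ), (ξ, η)) := by
  rw [sub_eq_add_neg, ← neg_smul]
  rfl

/-- The distribution `A_B(x, p; ξ_x, ξ_p) = a(x - ξ_p/2, p + ξ_x/2)` on the double phase space. -/
noncomputable def boppSymbol (a : 𝓢'(Vec n × Vec n, ℂ)) :
    𝓢'((Vec n × Vec n) × (Vec n × Vec n), ℂ) :=
  pullback (boppMap n) (tensorOne (Vec n × Vec n) (Vec n × Vec n) a)

/-- The symbol `a(x, ξ) = L(x, ξ)` given by a real linear form `L`, as a tempered distribution. -/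
noncomputable def linearSymbol (L : (Vec n × Vec n) →L[ℝ] ℝ) : 𝓢'(Vec n × Vec n, ℂ) :=
  (Complex.ofRealCLM.comp L).hasTemperateGrowth.toTemperedDistribution

theorem linearSymbol_apply (L : (Vec n × Vec n) →L[ℝ] ℝ) (φ : 𝓢(Vec n × Vec n, ℂ)) :
    linearSymbol n L φ = ∫ z, φ z * (L z : ℂ) := rfl

end BoppOperators

end Bopp

/-! At `theta0` one has cos kθ₀ = 3/4 and k⁻¹ sin kθ₀ = 1/4, so the flow is the unimodular map (x,
ξ) ↦ ((x + ξ)/2, ξ - x), the inverse of the Weyl change of variables up to a swap. The Bopp operator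
is therefore conjugation by a partial Fourier transform and a centre/difference substitution, and
its kernel can be computed exactly.

Everything is moved onto test functions. The pairing of `boppOp n a Ψ` with Χ is a constant times
`a` applied to a Schwartz function of (X, P) built from Χ and Ψ. The operator whose Weyl symbol is
`boppSymbol n a` has the same form. So it is enough that the two Schwartz functions agree with their
constants (`boppOp_eq_kernelOp`), and no regularity or approximation of `a` is needed.

On the operator side, Parseval in p (`contract_partialFourier`) leaves one integral over ξ of a
product of a partial inverse transform of Χ and a partial transform of Ψ at flowed points.
Substituting y → 2y and ξ → 2u - X puts the positions at u ± y/2. Expanding both transforms with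
momenta m ± q/2 gives the phase 2(P - m)·y + 2(u - X)·q, all other terms cancelling
(`partialFourierInv_contract`). On the symbol side, integrating over ζ = (ξ_x, ξ_p) along the Bopp
shear and taking (u, m) = (X + ξ_p/2, P - ξ_x/2) as new variables gives the same phase
(`partialIntegral_boppMap`). Both are the integral of `boppIntegrand`, with the same Jacobian 4ⁿ.

That `boppSymbol n a` is the Weyl symbol then follows from Fourier inversion on the doubled space
(`weylSymbol_weylKernel`). For a linear `a` the Bopp symbol is a linear function of position plus
one of momentum, and the Weyl quantization of such a function is computed directly in
`weylKernel_linear`. -/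

namespace Bopp
open DotProduct

/-! ### Volume-preserving linear maps and pullback without a Jacobian -/

section Volume

set_option linter.unusedSectionVars false

variable {X Y : Type} [NormedAddCommGroup X] [NormedSpace ℝ X] [NormedAddCommGroup Y]
  [NormedSpace ℝ Y] [FiniteDimensional ℝ X] [FiniteDimensional ℝ Y] [MeasureSpace X]
  [MeasureSpace Y] [BorelSpace X] [BorelSpace Y] [(volume : Measure X).IsAddHaarMeasure]
  [(volume : Measure Y).IsAddHaarMeasure]

theorem measurePreserving_shear_snd (J : X →L[ℝ] Y) :
    MeasurePreserving (fun z : X × Y => (z.1, z.2 + J z.1)) := by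
  have : ProperSpace X := FiniteDimensional.proper ℝ X
  have : ProperSpace Y := FiniteDimensional.proper ℝ Y
  exact (MeasurePreserving.id (volume : Measure X)).skew_product
    (g := fun x y => y + J x) (by fun_prop)
    (Filter.Eventually.of_forall fun x => (measurePreserving_add_right volume (J x)).map_eq)

theorem measurePreserving_swap : MeasurePreserving (Prod.swap : X × Y → Y × X) := by
  have : ProperSpace X := FiniteDimensional.proper ℝ X
  have : ProperSpace Y := FiniteDimensional.proper ℝ Y
  exact Measure.measurePreserving_swap

theorem measurePreserving_shear_fst (J : Y →L[ℝ] X) :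
    MeasurePreserving (fun z : X × Y => (z.1 + J z.2, z.2)) :=
  measurePreserving_swap.comp ((measurePreserving_shear_snd J).comp measurePreserving_swap)

theorem measurePreserving_neg_snd : MeasurePreserving (fun z : X × Y => (z.1, -z.2)) := by
  have : ProperSpace X := FiniteDimensional.proper ℝ X
  have : ProperSpace Y := FiniteDimensional.proper ℝ Y
  exact (MeasurePreserving.id (volume : Measure X)).prod (Measure.measurePreserving_neg volume)

variable (X) in
-- Factor through (x + y/2, y) and (x + y/2, -y): a shear, a reflection, then another shear.
theorem measurePreserving_weylMap : MeasurePreserving (weylMap X) := by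
  have h := (measurePreserving_shear_snd (ContinuousLinearMap.id ℝ X)).comp
    (measurePreserving_neg_snd.comp
      (measurePreserving_shear_fst ((1 / 2 : ℝ) • ContinuousLinearMap.id ℝ X)))
  convert h using 1
  ext1 ⟨x, y⟩
  rw [weylMap_apply]
  refine Prod.ext ?_ ?_ <;> simp
  module

/-- A linear map scales Haar measure by |det|⁻¹; comparing the two measures of the unit ball, which
is positive and finite, forces this factor to be 1. -/
theorem abs_det_eq_one {M : X ≃L[ℝ] X} (hM : MeasurePreserving M) :
    |(M : X →L[ℝ] X).det| = 1 := by
  have h := Measure.map_linearMap_addHaar_eq_smul_addHaar (volume : Measure X)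
    (f := ((M : X →L[ℝ] X) : X →ₗ[ℝ] X)) (LinearEquiv.isUnit_det' M.toLinearEquiv).ne_zero
  have h2 : Measure.map M (volume : Measure X) = volume := hM.map_eq
  change Measure.map M volume = _ at h
  rw [h2] at h
  have h3 := congrArg (fun μ => μ (Metric.ball 0 1)) h
  simp only [Measure.smul_apply, smul_eq_mul] at h3
  have : ProperSpace X := FiniteDimensional.proper ℝ X
  have h4 : ENNReal.ofReal |(LinearMap.det ((M : X →L[ℝ] X) : X →ₗ[ℝ] X))⁻¹| = 1 :=
    (ENNReal.mul_eq_right (Metric.measure_ball_pos volume 0 one_pos).ne'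
      measure_ball_lt_top.ne).mp h3.symm
  rw [ENNReal.ofReal_eq_one, abs_inv, inv_eq_one] at h4
  exact h4

theorem pullback_apply {M : X ≃L[ℝ] X} (hM : MeasurePreserving M) (u : 𝓢'(X, ℂ)) (φ : 𝓢(X, ℂ)) :
    pullback M u φ = u (compCLMOfContinuousLinearEquiv ℂ M.symm φ) := by
  change ((|(M : X →L[ℝ] X).det|⁻¹ : ℝ) : ℂ) • u _ = _
  rw [abs_det_eq_one hM, inv_one, Complex.ofReal_one, one_smul]
  rfl

theorem measurePreserving_symm {M : X ≃L[ℝ] X} (hM : MeasurePreserving M) :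
    MeasurePreserving M.symm :=
  MeasurePreserving.symm (e := M.toHomeomorph.toMeasurableEquiv) hM

theorem integral_comp_equiv {M : X ≃L[ℝ] X} (hM : MeasurePreserving M) (f : X → ℂ) :
    ∫ x, f (M x) = ∫ x, f x :=
  hM.integral_comp' (f := M.toHomeomorph.toMeasurableEquiv) f

end Volume

/-! ### Fourier inversion when the second variable is itself a product -/

section Inversion

variable {X Y V : Type} [NormedAddCommGroup X] [NormedSpace ℝ X] [NormedAddCommGroup Y]
  [NormedSpace ℝ Y] [DotProduct Y] [FiniteDimensional ℝ Y] [MeasureSpace Y] [BorelSpace Y]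
  [(volume : Measure Y).IsAddHaarMeasure] [NormedAddCommGroup V] [InnerProductSpace ℝ V]
  [FiniteDimensional ℝ V] [MeasurableSpace V] [BorelSpace V]

/-- The product `Vec n × Vec n` carries the sup norm, so the inversion theorem for inner product
spaces does not apply to it directly. It is transported along a linear equivalence that respects
both volume and the pairing; `e` need not be an isometry of the norm on `Y`. -/
theorem inversion_of_equiv (e : Y ≃L[ℝ] V) (he : MeasurePreserving e)
    (hdot : ∀ y y' : Y, dot y y' = inner ℝ (e y) (e y')) (Ψ : 𝓢(X × Y, ℂ)) :
    partialFourierInv (partialFourier Ψ) = Ψ := by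
  ext ⟨x, p⟩
  -- Properness of the slice map, so that the restriction of `Ψ` to a fibre is again Schwartz.
  have hup : ∀ v : V, ‖v‖ ≤ (1 + ‖(e : Y →L[ℝ] V)‖) * (1 + ‖((x, e.symm v) : X × Y)‖) ^ 1 := by
    intro v
    have h1 := norm_snd_le (x, e.symm v)
    have h2 := (e : Y →L[ℝ] V).le_opNorm (e.symm v)
    simp only [ContinuousLinearEquiv.coe_coe, ContinuousLinearEquiv.apply_symm_apply] at h2
    have h3 := norm_nonneg (e : Y →L[ℝ] V)
    have h4 := norm_nonneg (e.symm v)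
    rw [pow_one]
    nlinarith
  have htg : (fun v : V => ((x, e.symm v) : X × Y)).HasTemperateGrowth := by
    have h := (Function.HasTemperateGrowth.const (E := V) (x, (0 : Y))).add
      ((ContinuousLinearMap.inr ℝ X Y).comp (e.symm : V →L[ℝ] Y)).hasTemperateGrowth
    convert h using 1
    ext1 p
    simp
  let g : 𝓢(V, ℂ) := compCLM ℂ htg ⟨1, 1 + ‖(e : Y →L[ℝ] V)‖, hup⟩ Ψ
  have hg : ∀ v, g v = Ψ (x, e.symm v) := fun _ => rfl
  have hint : ∀ f : V → ℂ, ∫ y : Y, f (e y) = ∫ v, f v :=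
    fun f => he.integral_comp' (f := e.toHomeomorph.toMeasurableEquiv) f
  set c : ℂ := (((2 * Real.pi) ^ (-(Module.finrank ℝ Y : ℝ) / 2) : ℝ) : ℂ) with hc
  have h1 : ∀ ξ : Y, partialFourier Ψ (x, ξ) =
      c * FourierTransform.fourier (g : V → ℂ) ((2 * Real.pi)⁻¹ • e ξ) := by
    intro ξ
    rw [partialFourier_apply, Real.fourier_eq', ← hint]
    congr 2
    ext v
    rw [smul_eq_mul, hg, e.symm_apply_apply]
    congr 2
    rw [inner_smul_right, hdot, real_inner_comm (e ξ) (e v)]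
    have : -2 * Real.pi * ((2 * Real.pi)⁻¹ * inner ℝ (e ξ) (e v)) = - inner ℝ (e ξ) (e v) := by
      field_simp
    rw [this]
    push_cast
    ring
  have h2 : ∀ ξ : Y, Complex.exp (Complex.I * (dot p ξ : ℝ)) * partialFourier Ψ (x, ξ) =
      c * (fun η : V => Complex.exp (((2 * Real.pi * inner ℝ η (e p) : ℝ) : ℂ) * Complex.I) •
        FourierTransform.fourier (g : V → ℂ) η) ((2 * Real.pi)⁻¹ • e ξ) := by
    intro ξ
    rw [h1]
    simp only [smul_eq_mul]
    rw [mul_left_comm]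
    congr 3
    rw [inner_smul_left, real_inner_comm, hdot]
    have : 2 * Real.pi * ((starRingEnd ℝ) (2 * Real.pi)⁻¹ * inner ℝ (e p) (e ξ)) =
        inner ℝ (e p) (e ξ) := by
      simp only [conj_trivial]
      field_simp
    rw [this, mul_comm]
  rw [partialFourierInv_apply]
  simp only [h2]
  rw [integral_const_mul, hint (fun v => (fun η : V => Complex.exp (((2 * Real.pi *
      inner ℝ η (e p) : ℝ) : ℂ) * Complex.I) • FourierTransform.fourier (g : V → ℂ) η)
      ((2 * Real.pi)⁻¹ • v)), Measure.integral_comp_smul volume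
    (fun η : V => Complex.exp (((2 * Real.pi * inner ℝ η (e p) : ℝ) : ℂ) * Complex.I) •
        FourierTransform.fourier (g : V → ℂ) η), ← Real.fourierInv_eq',
    g.continuous.fourierInv_fourier_eq g.integrable (FourierTransform.fourier g).integrable, hg,
    ← hc, ← mul_assoc, Complex.real_smul, ← mul_assoc, e.symm_apply_apply]
  -- The two unitary normalizations cancel the Jacobian (2π)^d of passing to the kernel e^{-2πi}.
  have : c * c * ((|((2 * Real.pi)⁻¹ ^ Module.finrank ℝ V)⁻¹| : ℝ) : ℂ) = 1 := by
    rw [hc, ← e.toLinearEquiv.finrank_eq, ← Complex.ofReal_mul, ← Complex.ofReal_mul,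
      ← Real.rpow_add (by positivity), inv_pow, inv_inv, abs_of_pos (by positivity),
      ← Real.rpow_natCast, ← Real.rpow_add (by positivity)]
    have : -(Module.finrank ℝ Y : ℝ) / 2 + -(Module.finrank ℝ Y : ℝ) / 2 +
      (Module.finrank ℝ Y : ℝ) = 0 := by ring
    rw [this, Real.rpow_zero, Complex.ofReal_one]
  rw [this, one_mul]

theorem partialFourier_comp_reflect (Ψ : 𝓢(X × Y, ℂ)) :
    partialFourier (compCLMOfContinuousLinearEquiv ℂ (reflectSnd X Y) Ψ) =
      compCLMOfContinuousLinearEquiv ℂ (reflectSnd X Y) (partialFourier Ψ) := by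
  ext ⟨x, ξ⟩
  change _ = partialFourier Ψ (x, -ξ)
  rw [partialFourier_apply, partialFourier_apply]
  congr 1
  rw [← integral_neg_eq_self]
  congr 1
  ext p
  simp [reflectSnd]

variable {n : ℕ}

theorem partialFourierInv_partialFourier_prod (Ψ : 𝓢(X × (Vec n × Vec n), ℂ)) :
    partialFourierInv (partialFourier Ψ) = Ψ :=
  inversion_of_equiv (WithLp.prodContinuousLinearEquiv 2 ℝ (Vec n) (Vec n)).symm
    (WithLp.volume_preserving_toLp (Vec n) (Vec n)) (fun _ _ => rfl) Ψ

theorem partialFourier_partialFourierInv_prod (Ψ : 𝓢(X × (Vec n × Vec n), ℂ)) :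
    partialFourier (partialFourierInv Ψ) = Ψ := by
  have h := partialFourierInv_partialFourier_prod Ψ
  unfold partialFourierInv at h ⊢
  rw [ContinuousLinearMap.comp_apply] at h ⊢
  rw [partialFourier_comp_reflect]
  exact h

end Inversion

/-! ### Weyl kernels and symbols as mutually inverse operations -/

section WeylKernel

variable {X : Type} [NormedAddCommGroup X] [NormedSpace ℝ X] [DotProduct X]
  [FiniteDimensional ℝ X] [MeasureSpace X] [BorelSpace X] [(volume : Measure X).IsAddHaarMeasure]

theorem weylKernel_apply (a : 𝓢'(X × X, ℂ)) (F : 𝓢(X × X, ℂ)) :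
    weylKernel X a F = (((2 * Real.pi) ^ (-(Module.finrank ℝ X : ℝ) / 2) : ℝ) : ℂ) *
      a (partialFourierInv (compCLMOfContinuousLinearEquiv ℂ (weylMap X) F)) := by
  change _ * pullback (weylMap X).symm (transpose partialFourierInv a) F = _
  rw [pullback_apply (measurePreserving_symm (measurePreserving_weylMap X)), transpose_apply]
  rfl

/-- On test functions the two Weyl substitutions cancel, then the two partial Fourier transforms,
then the powers of 2π. -/
theorem weylSymbol_weylKernel
    (h : ∀ Φ : 𝓢(X × X, ℂ), partialFourierInv (partialFourier Φ) = Φ) (a : 𝓢'(X × X, ℂ)) :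
    weylSymbol X (weylKernel X a) = a := by
  ext φ
  change _ * pullback (weylMap X) (weylKernel X a) (partialFourier φ) = _
  rw [pullback_apply (measurePreserving_weylMap X), weylKernel_apply]
  have e : compCLMOfContinuousLinearEquiv ℂ (weylMap X)
      (compCLMOfContinuousLinearEquiv ℂ (weylMap X).symm (partialFourier φ)) =
        partialFourier φ := by
    ext z
    change partialFourier φ ((weylMap X).symm (weylMap X z)) = _
    rw [ContinuousLinearEquiv.symm_apply_apply]
  rw [e, h, ← mul_assoc, ← Complex.ofReal_mul, ← Real.rpow_add (by positivity), neg_div,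
    add_neg_cancel, Real.rpow_zero, Complex.ofReal_one, one_mul]

end WeylKernel

/-! ### The Bopp shear and the flow at `theta0` -/

section BoppMaps

variable {n : ℕ}

theorem measurePreserving_boppMap : MeasurePreserving (boppMap n) :=
  measurePreserving_shear_fst (X := Vec n × Vec n) (Y := Vec n × Vec n)
    ((-(1 / 2 : ℝ) • ContinuousLinearMap.snd ℝ (Vec n) (Vec n)).prod
      ((1 / 2 : ℝ) • ContinuousLinearMap.fst ℝ (Vec n) (Vec n)))

instance instHaarDoublePhaseSpace :
    (volume : Measure ((Vec n × Vec n) × (Vec n × Vec n))).IsAddHaarMeasure :=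
  instHaarProd (Vec n × Vec n) (Vec n × Vec n)

theorem boppSymbol_apply (a : 𝓢'(Vec n × Vec n, ℂ))
    (φ : 𝓢((Vec n × Vec n) × (Vec n × Vec n), ℂ)) :
    boppSymbol n a φ =
      a (partialIntegral (compCLMOfContinuousLinearEquiv ℂ (boppMap n).symm φ)) :=
  pullback_apply (X := (Vec n × Vec n) × (Vec n × Vec n)) measurePreserving_boppMap _ _

theorem freq_mul_theta0 : freq * theta0 = Real.arccos (3 / 4) := by
  have h := freq_sq
  unfold freq at h
  unfold freq theta0
  linear_combination (Real.arccos (3 / 4) / 7) * h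

theorem cos_freq_mul_theta0 : Real.cos (freq * theta0) = 3 / 4 := by
  rw [freq_mul_theta0, Real.cos_arccos (by norm_num) (by norm_num)]

theorem sin_freq_mul_theta0 : freq⁻¹ * Real.sin (freq * theta0) = 1 / 4 := by
  rw [freq_mul_theta0, Real.sin_arccos, inv_mul_eq_div, div_eq_iff freq_ne, freq,
    show (1 - (3 / 4) ^ 2 : ℝ) = 7 / 4 ^ 2 by norm_num, Real.sqrt_div' _ (by norm_num),
    Real.sqrt_sq (by norm_num)]
  ring

/-- The values 3/4 and 1/4 make the coefficients 1/2, 1/2 and 1, -1; this is why `theta0` is the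
right time. -/
theorem flow_theta0_apply (x ξ : Vec n) :
    flow n theta0 (x, ξ) = ((1 / 2 : ℝ) • (x + ξ), ξ - x) := by
  change flowMap n theta0 (x, ξ) = _
  have hs := sin_freq_mul_theta0
  rw [flowMap_apply, mul_assoc 2, mul_assoc 4, hs, cos_freq_mul_theta0]
  refine Prod.ext ?_ ?_
  · change _ = (1 / 2 : ℝ) • (x + ξ)
    module
  · change _ = ξ - x
    module

theorem measurePreserving_flow_theta0 : MeasurePreserving (flow n theta0) := by
  have h := (measurePreserving_symm (measurePreserving_weylMap (Vec n))).comp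
    measurePreserving_swap
  have e : (flow n theta0 : Vec n × Vec n → Vec n × Vec n) =
      (weylMap (Vec n)).symm ∘ Prod.swap := by
    funext ⟨x, ξ⟩
    rw [flow_theta0_apply]
    change _ = (weylMap (Vec n)).symm (ξ, x)
    rw [weylMap_symm_apply]
    refine Prod.ext ?_ rfl
    change (1 / 2 : ℝ) • (x + ξ) = _
    module
  rw [e]
  exact h

end BoppMaps

/-! ### Rescaling and reordering integrals -/

section Fubini

set_option linter.unusedSectionVars false

variable {X : Type} [NormedAddCommGroup X] [NormedSpace ℝ X] [FiniteDimensional ℝ X]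
  [MeasureSpace X] [BorelSpace X] [(volume : Measure X).IsAddHaarMeasure]

theorem integral_eq_two_pow_mul (h : X → ℂ) :
    ∫ x, h x = (2 : ℂ) ^ Module.finrank ℝ X * ∫ x, h ((2 : ℝ) • x) := by
  rw [Measure.integral_comp_smul, abs_of_pos (by positivity), Complex.real_smul, ← mul_assoc]
  push_cast
  rw [mul_inv_cancel₀ (pow_ne_zero _ two_ne_zero), one_mul]

theorem measurePreserving_prodProdProdComm {α β γ δ : Type} [MeasureSpace α] [MeasureSpace β]
    [MeasureSpace γ] [MeasureSpace δ] [SigmaFinite (volume : Measure α)]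
    [SigmaFinite (volume : Measure β)] [SigmaFinite (volume : Measure γ)]
    [SigmaFinite (volume : Measure δ)] :
    MeasurePreserving (fun z : (α × β) × (γ × δ) => ((z.1.1, z.2.1), (z.1.2, z.2.2))) := by
  have h1 : MeasurePreserving (fun z : β × (γ × δ) => (z.2.1, (z.1, z.2.2))) :=
    (volume_preserving_prodAssoc (α₁ := γ) (β₁ := β) (γ₁ := δ)).comp
      ((Measure.measurePreserving_swap.prod (MeasurePreserving.id (volume : Measure δ))).comp
        ((volume_preserving_prodAssoc (α₁ := β) (β₁ := γ) (γ₁ := δ)).symm))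
  exact ((volume_preserving_prodAssoc (α₁ := α) (β₁ := γ) (γ₁ := β × δ)).symm).comp
      (((MeasurePreserving.id (volume : Measure α)).prod h1).comp
        (volume_preserving_prodAssoc (α₁ := α) (β₁ := β) (γ₁ := γ × δ)))

/-- The operator side produces the order y, u, (m, q), while the symbol side groups centres (u, m)
before differences (y, q). -/
theorem integral_shuffle {D : (X × X) × (X × X) → ℂ} (hD : Integrable D) :
    ∫ y, ∫ u, ∫ w : X × X, D ((u, w.1), (y, w.2)) = ∫ z, ∫ w, D (z, w) := by
  have : ProperSpace X := FiniteDimensional.proper ℝ X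
  have hp : MeasurePreserving
      (fun z : (X × X) × (X × X) => ((z.1.2, z.2.1), (z.1.1, z.2.2))) :=
    measurePreserving_prodProdProdComm.comp
      (Measure.measurePreserving_swap.prod (MeasurePreserving.id (volume : Measure (X × X))))
  have hD' := hp.integrable_comp_of_integrable hD
  have e : ∫ z, D z = ∫ z : (X × X) × (X × X), D ((z.1.2, z.2.1), (z.1.1, z.2.2)) := by
    have h := integral_map (f := D) hp.measurable.aemeasurable
      (by rw [hp.map_eq]; exact hD.aestronglyMeasurable)
    rwa [hp.map_eq] at h
  have e1 := integral_prod (μ := (volume : Measure (X × X))) (ν := (volume : Measure (X × X))) _ hD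
  have e2 := integral_prod (μ := (volume : Measure (X × X))) (ν := (volume : Measure (X × X))) _ hD'
  have e3 := integral_prod (μ := (volume : Measure X)) (ν := (volume : Measure X)) _
    (Integrable.integral_prod_left (μ := (volume : Measure (X × X)))
      (ν := (volume : Measure (X × X))) hD')
  exact (e1.symm.trans (e.trans (e2.trans e3))).symm

end Fubini

/-! ### The kernel of the Bopp operator -/

variable {n : ℕ}

theorem dot_comm (x y : Vec n) : dot x y = dot y x := real_inner_comm y x

/-- Parseval in bilinear form: the phase is symmetric in its two arguments, so by Fubini the
transform moves from one factor to the other, where it cancels the inverse transform. -/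
theorem integral_partialFourier_mul (f g : 𝓢(Vec n × Vec n, ℂ)) (x x' : Vec n) :
    ∫ p, partialFourier f (x, p) * partialFourierInv g (x', p) = ∫ ξ, f (x, ξ) * g (x', ξ) := by
  conv_rhs => rw [← partialFourier_partialFourierInv g]
  set h := partialFourierInv g
  simp only [partialFourier_apply]
  set c : ℂ := (((2 * Real.pi) ^ (-(Module.finrank ℝ (Vec n) : ℝ) / 2) : ℝ) : ℂ)
  have hi : Integrable (fun z : Vec n × Vec n =>
      Complex.exp (-(Complex.I * (dot z.1 z.2 : ℝ))) * (h (x', z.1) * f (x, z.2))) := by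
    refine ((osc_integrable h x').mul_prod (osc_integrable f x)).mono
      (Continuous.aestronglyMeasurable (by fun_prop)) (Filter.Eventually.of_forall fun p => ?_)
    rw [norm_mul, norm_exp_dot, one_mul]
  have hs := integral_integral_swap (μ := (volume : Measure (Vec n)))
    (ν := (volume : Measure (Vec n)))
    (f := fun p ξ => Complex.exp (-(Complex.I * (dot p ξ : ℝ))) * (h (x', p) * f (x, ξ))) hi
  have e1 : ∀ p : Vec n, c * (∫ ξ : Vec n, Complex.exp (-(Complex.I * (dot p ξ : ℝ))) * f (x, ξ)) *
      h (x', p) = c * ∫ ξ : Vec n, Complex.exp (-(Complex.I * (dot p ξ : ℝ))) *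
        (h (x', p) * f (x, ξ)) := by
    intro p
    rw [mul_assoc, ← integral_mul_const]
    congr 2
    ext ξ
    ring
  have e2 : ∀ ξ : Vec n, f (x, ξ) * (c * ∫ p : Vec n,
      Complex.exp (-(Complex.I * (dot ξ p : ℝ))) * h (x', p)) =
        c * ∫ p : Vec n, Complex.exp (-(Complex.I * (dot p ξ : ℝ))) *
          (h (x', p) * f (x, ξ)) := by
    intro ξ
    rw [mul_left_comm, ← integral_const_mul]
    congr 2
    ext p
    rw [dot_comm p ξ]
    ring
  simp only [e1, e2]
  rw [integral_const_mul, integral_const_mul, hs]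

theorem contract_partialFourier (f g : 𝓢(Vec n × Vec n, ℂ)) (x x' : Vec n) :
    contract n (tensor (partialFourier f) (partialFourierInv g)) (x, x') =
      ∫ ξ, f (x, ξ) * g (x', ξ) := by
  rw [contract_apply, ← integral_partialFourier_mul]
  rfl

theorem comp_equiv_apply {V W : Type} [NormedAddCommGroup V] [NormedSpace ℝ V]
    [NormedAddCommGroup W] [NormedSpace ℝ W] (e : V ≃L[ℝ] W) (f : 𝓢(W, ℂ)) (v : V) :
    compCLMOfContinuousLinearEquiv ℂ e f v = f (e v) := rfl

/-- Both arguments get composed with the same forward flow: on Ψ it comes from the inverse operator,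
on Χ from transposing the transport. No determinant appears, the flow being volume preserving. -/
theorem boppOp_apply_apply (a : 𝓢'(Vec n × Vec n, ℂ)) (Ψ Χ : 𝓢(Vec n × Vec n, ℂ)) :
    boppOp n a Ψ Χ = weylKernel (Vec n) a (contract n (tensor
      (partialFourier (compCLMOfContinuousLinearEquiv ℂ (flow n theta0) (partialFourierInv Χ)))
      (partialFourierInv
        (compCLMOfContinuousLinearEquiv ℂ (flow n theta0) (partialFourier Ψ))))) := by
  have hm : MeasurePreserving (flow n (-theta0)) := measurePreserving_symm
    (measurePreserving_flow_theta0 (n := n))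
  have h1 : ∀ z, (flow n (-theta0)).symm z = flow n theta0 z := fun z => by
    change flowMap n (- -theta0) z = flowMap n theta0 z
    rw [neg_neg]
  have e1 : compCLMOfContinuousLinearEquiv ℂ (flow n (-theta0)).symm (partialFourierInv Χ) =
      compCLMOfContinuousLinearEquiv ℂ (flow n theta0) (partialFourierInv Χ) := by
    ext z
    exact congrArg (partialFourierInv Χ) (h1 z)
  have e2 : transport n (-theta0) (partialFourier Ψ) =
      compCLMOfContinuousLinearEquiv ℂ (flow n theta0) (partialFourier Ψ) := by
    ext z
    exact congrArg (partialFourier Ψ) (h1 z)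
  change pullback (flow n (-theta0)) (transpose partialFourier (phaseSpaceExt n a
    (partialFourierInv (transport n (-theta0) (partialFourier Ψ))))) (partialFourierInv Χ) = _
  rw [pullback_apply hm, e1, e2]
  rfl

theorem partialFourierInv_mul_partialFourier (Χ Ψ : 𝓢(Vec n × Vec n, ℂ)) (x x' ξ ξ' : Vec n) :
    partialFourierInv Χ (x, ξ) * partialFourier Ψ (x', ξ') =
      (((2 * Real.pi) ^ (-(Module.finrank ℝ (Vec n) : ℝ) / 2) : ℝ) : ℂ) ^ 2 *
        ∫ w : Vec n × Vec n, Complex.exp (Complex.I * ((dot ξ (w.1 + (1 / 2 : ℝ) • w.2) -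
          dot ξ' (w.1 - (1 / 2 : ℝ) • w.2) : ℝ) : ℂ)) *
          (Χ (x, w.1 + (1 / 2 : ℝ) • w.2) * Ψ (x', w.1 - (1 / 2 : ℝ) • w.2)) := by
  rw [partialFourierInv_apply, partialFourier_apply, mul_mul_mul_comm, ← sq]
  congr 1
  have h1 := integral_prod_mul (μ := (volume : Measure (Vec n))) (ν := (volume : Measure (Vec n)))
    (fun p => Complex.exp (Complex.I * (dot ξ p : ℝ)) * Χ (x, p))
    (fun p => Complex.exp (-(Complex.I * (dot ξ' p : ℝ))) * Ψ (x', p))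
  rw [← h1]
  -- The two dual variables become m + q/2 and m - q/2.
  refine (integral_comp_equiv (measurePreserving_weylMap (Vec n)) _).symm.trans ?_
  congr 1
  ext ⟨m, q⟩
  rw [weylMap_apply]
  dsimp only
  rw [mul_mul_mul_comm, ← Complex.exp_add]
  congr 2
  push_cast
  ring

/-- The integrand, in centre and difference coordinates, of both kernels at the phase-space point
`Z`. -/
noncomputable def boppIntegrand (Χ Ψ : 𝓢(Vec n × Vec n, ℂ)) (Z : Vec n × Vec n)
    (t : (Vec n × Vec n) × (Vec n × Vec n)) : ℂ :=
  Complex.exp (Complex.I * ((dot ((2 : ℝ) • (Z.2 - t.1.2)) t.2.1 +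
    dot ((2 : ℝ) • (t.1.1 - Z.1)) t.2.2 : ℝ) : ℂ)) *
    tensor Χ Ψ (weylMap (Vec n × Vec n) t)

theorem integrable_boppIntegrand (Χ Ψ : 𝓢(Vec n × Vec n, ℂ)) (Z : Vec n × Vec n) :
    Integrable (boppIntegrand Χ Ψ Z) := by
  have h : Integrable (fun t => tensor Χ Ψ (weylMap (Vec n × Vec n) t)) :=
    (compCLMOfContinuousLinearEquiv ℂ (weylMap (Vec n × Vec n)) (tensor Χ Ψ)).integrable
  refine h.mono (Continuous.aestronglyMeasurable ?_) (Filter.Eventually.of_forall fun t => ?_)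
  · unfold boppIntegrand
    have := (weylMap (Vec n × Vec n)).continuous
    fun_prop
  · rw [boppIntegrand, norm_mul, Complex.norm_exp]
    simp

/-- The factor 4ⁿ is 2ⁿ from doubling y times 2ⁿ from doubling ξ. Of the three 2π constants, two
come from expanding Χ and Ψ and one from the outer inverse transform. -/
theorem partialFourierInv_contract (Χ Ψ : 𝓢(Vec n × Vec n, ℂ)) (X P : Vec n) :
    partialFourierInv (compCLMOfContinuousLinearEquiv ℂ (weylMap (Vec n)) (contract n (tensor
      (partialFourier (compCLMOfContinuousLinearEquiv ℂ (flow n theta0) (partialFourierInv Χ)))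
      (partialFourierInv
        (compCLMOfContinuousLinearEquiv ℂ (flow n theta0) (partialFourier Ψ)))))) (X, P) =
      (((2 * Real.pi) ^ (-(Module.finrank ℝ (Vec n) : ℝ) / 2) : ℝ) : ℂ) ^ 3 * 4 ^ n *
        ∫ z, ∫ w, boppIntegrand Χ Ψ (X, P) (z, w) := by
  set c : ℂ := (((2 * Real.pi) ^ (-(Module.finrank ℝ (Vec n) : ℝ) / 2) : ℝ) : ℂ) with hc
  have h1 : ∀ y : Vec n, compCLMOfContinuousLinearEquiv ℂ (weylMap (Vec n)) (contract n (tensor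
      (partialFourier (compCLMOfContinuousLinearEquiv ℂ (flow n theta0) (partialFourierInv Χ)))
      (partialFourierInv
        (compCLMOfContinuousLinearEquiv ℂ (flow n theta0) (partialFourier Ψ))))) (X, y) =
      ∫ ξ, partialFourierInv Χ ((1 / 2 : ℝ) • (X + (1 / 2 : ℝ) • y + ξ), ξ - (X + (1 / 2 : ℝ) • y)) *
        partialFourier Ψ ((1 / 2 : ℝ) • (X - (1 / 2 : ℝ) • y + ξ), ξ - (X - (1 / 2 : ℝ) • y)) := by
    intro y
    rw [comp_equiv_apply, weylMap_apply, contract_partialFourier]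
    simp only [comp_equiv_apply, flow_theta0_apply]
  rw [partialFourierInv_apply, ← integral_shuffle (integrable_boppIntegrand Χ Ψ (X, P)),
    integral_eq_two_pow_mul, ← hc]
  have h2 : ∀ y : Vec n, Complex.exp (Complex.I * (dot P ((2 : ℝ) • y) : ℝ)) *
      compCLMOfContinuousLinearEquiv ℂ (weylMap (Vec n)) (contract n (tensor
        (partialFourier (compCLMOfContinuousLinearEquiv ℂ (flow n theta0) (partialFourierInv Χ)))
        (partialFourierInv
          (compCLMOfContinuousLinearEquiv ℂ (flow n theta0) (partialFourier Ψ))))) (X, (2 : ℝ) • y) =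
      2 ^ n * c ^ 2 * ∫ u, ∫ w : Vec n × Vec n,
        boppIntegrand Χ Ψ (X, P) ((u, w.1), (y, w.2)) := by
    intro y
    -- Substitute ξ = 2u - X, which removes X from the positions and leaves it only in the phase.
    rw [h1, ← integral_sub_right_eq_self _ X, integral_eq_two_pow_mul, finrank_euclideanSpace_fin,
      mul_left_comm, mul_assoc]
    congr 1
    rw [← integral_const_mul, ← integral_const_mul]
    congr 1
    ext u
    rw [partialFourierInv_mul_partialFourier, ← hc, mul_left_comm, ← integral_const_mul]
    congr 2
    ext w
    rw [← mul_assoc, ← Complex.exp_add]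
    have a1 : (1 / 2 : ℝ) • (X + (1 / 2 : ℝ) • (2 : ℝ) • y + ((2 : ℝ) • u - X)) =
      u + (1 / 2 : ℝ) • y := by module
    have a2 : (1 / 2 : ℝ) • (X - (1 / 2 : ℝ) • (2 : ℝ) • y + ((2 : ℝ) • u - X)) =
      u - (1 / 2 : ℝ) • y := by module
    rw [a1, a2, boppIntegrand]
    congr 2
    rw [← mul_add, ← Complex.ofReal_add]
    congr 2
    -- The momenta are 2(u - X) ∓ y; paired with m ± q/2, the m·(u - X) and y·q terms cancel.
    simp only [map_sub, map_add, map_smul, _root_.sub_apply, _root_.add_apply,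
      _root_.smul_apply, smul_eq_mul]
    rw [dot_comm w.1 y]
    ring
  simp only [h2]
  rw [integral_const_mul, finrank_euclideanSpace_fin, show (4 : ℂ) = 2 * 2 by norm_num, mul_pow]
  ring

/-! ### The kernel of the Bopp symbol, and the comparison -/

theorem boppMap_symm_apply (x p ξ η : Vec n) : (boppMap n).symm ((x, p), (ξ, η)) =
    ((x + (1 / 2 : ℝ) • η, p - (1 / 2 : ℝ) • ξ), (ξ, η)) := by
  rw [ContinuousLinearEquiv.symm_apply_eq, boppMap_apply, add_sub_cancel_right, sub_add_cancel]

/-- For fixed (X, P) the sheared position determines the momentum, so it can serve as integration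
variable: a dilation by 2 in dimension 2n, a translation and a quarter turn. -/
theorem integral_boppMap_symm (X P : Vec n) (h : (Vec n × Vec n) × (Vec n × Vec n) → ℂ) :
    ∫ ζ, h ((boppMap n).symm ((X, P), ζ)) = 4 ^ n * ∫ z : Vec n × Vec n,
      h (z, ((2 : ℝ) • (P - z.2), (2 : ℝ) • (z.1 - X))) := by
  have hd : Module.finrank ℝ (Vec n × Vec n) = 2 * n := by
    rw [Module.finrank_prod, finrank_euclideanSpace_fin, two_mul]
  rw [integral_eq_two_pow_mul, hd, pow_mul, show (2 : ℂ) ^ 2 = 4 by norm_num]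
  congr 1
  let e : (Vec n × Vec n) ≃L[ℝ] (Vec n × Vec n) :=
    (reflectSnd (Vec n) (Vec n)).trans (ContinuousLinearEquiv.prodComm ℝ (Vec n) (Vec n))
  have he : MeasurePreserving e := measurePreserving_swap.comp measurePreserving_neg_snd
  rw [← integral_add_right_eq_self _ ((P, -X) : Vec n × Vec n), ← integral_comp_equiv he]
  congr 1
  ext ⟨u, m⟩
  have e1 : (2 : ℝ) • (e (u, m) + (P, -X)) = ((2 : ℝ) • (P - m), (2 : ℝ) • (u - X)) := by
    change (2 : ℝ) • ((-m, u) + (P, -X)) = _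
    refine Prod.ext ?_ ?_
    · change (2 : ℝ) • (-m + P) = (2 : ℝ) • (P - m)
      module
    · change (2 : ℝ) • (u + -X) = (2 : ℝ) • (u - X)
      module
  rw [e1, boppMap_symm_apply]
  congr 3
  · module
  · module

theorem partialIntegral_boppMap (Χ Ψ : 𝓢(Vec n × Vec n, ℂ)) (X P : Vec n) :
    partialIntegral (compCLMOfContinuousLinearEquiv ℂ (boppMap n).symm (partialFourierInv
      (compCLMOfContinuousLinearEquiv ℂ (weylMap (Vec n × Vec n)) (tensor Χ Ψ)))) (X, P) =
      (((2 * Real.pi) ^ (-(Module.finrank ℝ (Vec n × Vec n) : ℝ) / 2) : ℝ) : ℂ) * 4 ^ n *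
        ∫ z, ∫ w, boppIntegrand Χ Ψ (X, P) (z, w) := by
  rw [partialIntegral_apply]
  simp only [comp_equiv_apply]
  rw [integral_boppMap_symm X P (fun t => partialFourierInv
      (compCLMOfContinuousLinearEquiv ℂ (weylMap (Vec n × Vec n)) (tensor Χ Ψ)) t)]
  simp only [partialFourierInv_apply]
  rw [integral_const_mul, mul_left_comm, mul_assoc]
  rfl

theorem boppOp_eq_kernelOp (a : 𝓢'(Vec n × Vec n, ℂ)) :
    boppOp n a = kernelOp (weylKernel (Vec n × Vec n) (boppSymbol n a)) := by
  ext Ψ Χ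
  have ha : ∀ (c : ℂ) φ, c * a φ = a (c • φ) := fun c φ => (map_smul a c φ).symm
  rw [kernelOp_apply, boppOp_apply_apply, weylKernel_apply, weylKernel_apply, boppSymbol_apply,
    ha, ha]
  -- Both sides are `a` at a Schwartz function, so only these functions need to be compared.
  refine congrArg a ?_
  ext ⟨X, P⟩
  rw [smul_apply, smul_apply, partialFourierInv_contract, partialIntegral_boppMap]
  -- The constants match because 1 + 3 factors in dimension n equal 2 factors in dimension 2n.
  have hc : (((2 * Real.pi) ^ (-(Module.finrank ℝ (Vec n × Vec n) : ℝ) / 2) : ℝ) : ℂ) =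
      (((2 * Real.pi) ^ (-(Module.finrank ℝ (Vec n) : ℝ) / 2) : ℝ) : ℂ) ^ 2 := by
    rw [← Complex.ofReal_pow, ← Real.rpow_mul_natCast (by positivity), Module.finrank_prod]
    push_cast
    congr 2
    ring
  rw [hc, smul_eq_mul, smul_eq_mul]
  ring

theorem isWeylSymbol_boppOp (a : 𝓢'(Vec n × Vec n, ℂ)) :
    IsWeylSymbol (Vec n × Vec n) (boppOp n a) (boppSymbol n a) :=
  ⟨_, boppOp_eq_kernelOp a,
    (weylSymbol_weylKernel partialFourierInv_partialFourier_prod (boppSymbol n a)).symm⟩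

/-! ### Weyl quantization of linear symbols -/

section LinearSymbol

set_option linter.unusedSectionVars false

variable {X Y : Type} [NormedAddCommGroup X] [NormedSpace ℝ X] [NormedAddCommGroup Y]
  [NormedSpace ℝ Y] [DotProduct Y] [FiniteDimensional ℝ Y] [MeasureSpace Y] [BorelSpace Y]
  [(volume : Measure Y).IsAddHaarMeasure]

theorem integrable_linear_mul [MeasureSpace X] [BorelSpace X] [FiniteDimensional ℝ X]
    [(volume : Measure X).IsAddHaarMeasure] (L : X →L[ℝ] ℝ) (f : 𝓢(X, ℂ)) :
    Integrable (fun x => (L x : ℂ) * f x) := by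
  refine ((f.integrable_pow_mul volume 1).const_mul ‖L‖).mono'
    (Continuous.aestronglyMeasurable (by fun_prop)) (Filter.Eventually.of_forall fun x => ?_)
  rw [norm_mul, Complex.norm_real, pow_one, ← mul_assoc]
  gcongr
  exact L.le_opNorm x

/-- Inversion evaluated at frequency zero. -/
theorem integral_partialFourierInv
    (h : ∀ Φ : 𝓢(X × Y, ℂ), partialFourier (partialFourierInv Φ) = Φ) (G : 𝓢(X × Y, ℂ)) (x : X) :
    (((2 * Real.pi) ^ (-(Module.finrank ℝ Y : ℝ) / 2) : ℝ) : ℂ) *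
      ∫ ξ, partialFourierInv G (x, ξ) = G (x, 0) := by
  conv_rhs => rw [← h G, partialFourier_apply]
  simp

theorem oscD_apply_zero (f : 𝓢(X × Y, ℂ)) (x : X) (y v : Y) :
    oscD f (x, y) (0, v) = -Complex.I * ((dot v y : ℂ) * f (x, y)) := by
  rw [oscD_apply]
  change fderiv ℝ f (x, y) 0 - Complex.I * ((dot v y : ℂ) * f (x, y)) = _
  rw [map_zero, zero_sub, neg_mul]

/-- Up to a factor i, the integrand is a component of the Schwartz function `oscD f`. -/
theorem integrable_dot_mul (f : 𝓢(X × Y, ℂ)) (x : X) (v : Y) :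
    Integrable (fun y => (dot v y : ℂ) * f (x, y)) := by
  have h := ((osc_integrable (oscD f) x).apply_continuousLinearMap (0, v)).const_mul Complex.I
  refine h.congr (Filter.Eventually.of_forall fun y => ?_)
  change Complex.I * oscD f (x, y) (0, v) = _
  rw [oscD_apply_zero]
  linear_combination -((dot v y : ℂ) * f (x, y)) * Complex.I_mul_I

/-- Differentiate the inversion formula under the integral at frequency zero: a momentum weight
becomes i times a derivative in the difference variable. -/
theorem integral_dot_mul_partialFourierInv
    (h : ∀ Φ : 𝓢(X × Y, ℂ), partialFourier (partialFourierInv Φ) = Φ) (G : 𝓢(X × Y, ℂ)) (x : X)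
    (v : Y) : (((2 * Real.pi) ^ (-(Module.finrank ℝ Y : ℝ) / 2) : ℝ) : ℂ) *
      ∫ ξ, (dot v ξ : ℂ) * partialFourierInv G (x, ξ) =
        Complex.I * fderiv ℝ G (x, 0) (0, v) := by
  set c : ℂ := (((2 * Real.pi) ^ (-(Module.finrank ℝ Y : ℝ) / 2) : ℝ) : ℂ)
  set Φ := partialFourierInv G
  have h1 : (G : X × Y → ℂ) = fun z => c • osc Φ z := by
    rw [← h G]
    rfl
  have h2 : fderiv ℝ G (x, 0) (0, v) = c • osc (oscD Φ) (x, 0) (0, v) := by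
    have h := (osc_hasFDerivAt Φ (x, 0)).const_smul c
    rw [h1]
    exact congrArg (fun T => T (0, v)) h.fderiv
  have h3 : osc (oscD Φ) (x, 0) (0, v) = -Complex.I * ∫ ξ, (dot v ξ : ℂ) * Φ (x, ξ) := by
    refine (ContinuousLinearMap.integral_apply
      (osc_integrand_integrable (oscD Φ) (x, 0)) (0, v)).trans ?_
    rw [← integral_const_mul]
    congr 1
    ext ξ
    change Complex.exp (-(Complex.I * (dot (0 : Y) ξ : ℝ))) • oscD Φ (x, ξ) (0, v) = _
    rw [oscD_apply_zero]
    simp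
  rw [h2, h3, smul_eq_mul]
  linear_combination (c * ∫ ξ, (dot v ξ : ℂ) * Φ (x, ξ)) * Complex.I_mul_I

theorem tensor_weylMap_zero (φ ψ : 𝓢(Y, ℂ)) (x : Y) :
    compCLMOfContinuousLinearEquiv ℂ (weylMap Y) (tensor φ ψ) (x, 0) = φ x * ψ x := by
  rw [comp_equiv_apply, weylMap_apply, tensor_apply, smul_zero, add_zero, sub_zero]

theorem fderiv_tensor_weylMap_zero (φ ψ : 𝓢(Y, ℂ)) (x v : Y) :
    fderiv ℝ (compCLMOfContinuousLinearEquiv ℂ (weylMap Y) (tensor φ ψ)) (x, 0) (0, v) =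
      1 / 2 * (fderiv ℝ φ x v * ψ x - φ x * fderiv ℝ ψ x v) := by
  have hw : weylMap Y (x, 0) = (x, x) := by
    rw [weylMap_apply, smul_zero, add_zero, sub_zero]
  have h1 : HasFDerivAt (fun z : Y × Y => φ (weylMap Y z).1)
      ((fderiv ℝ φ x).comp ((ContinuousLinearMap.fst ℝ Y Y).comp
        (weylMap Y : (Y × Y) →L[ℝ] (Y × Y)))) (x, 0) := by
    refine HasFDerivAt.comp (g := φ) (x, (0 : Y)) ?_ ((ContinuousLinearMap.fst ℝ Y Y).comp
        (weylMap Y : (Y × Y) →L[ℝ] (Y × Y))).hasFDerivAt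
    change HasFDerivAt φ (fderiv ℝ φ x) (weylMap Y (x, 0)).1
    rw [hw]
    exact φ.hasFDerivAt x
  have h2 : HasFDerivAt (fun z : Y × Y => ψ (weylMap Y z).2)
      ((fderiv ℝ ψ x).comp ((ContinuousLinearMap.snd ℝ Y Y).comp
        (weylMap Y : (Y × Y) →L[ℝ] (Y × Y)))) (x, 0) := by
    refine HasFDerivAt.comp (g := ψ) (x, (0 : Y)) ?_ ((ContinuousLinearMap.snd ℝ Y Y).comp
        (weylMap Y : (Y × Y) →L[ℝ] (Y × Y))).hasFDerivAt
    change HasFDerivAt ψ (fderiv ℝ ψ x) (weylMap Y (x, 0)).2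
    rw [hw]
    exact ψ.hasFDerivAt x
  have h3 := h1.mul h2
  change fderiv ℝ (fun z : Y × Y => φ (weylMap Y z).1 * ψ (weylMap Y z).2) (x, 0) (0, v) = _
  refine (congrArg (fun T => T (0, v)) h3.fderiv).trans ?_
  have e1 : (weylMap Y (0, v)).1 = (1 / 2 : ℝ) • v := by rw [weylMap_apply, zero_add]
  have e2 : (weylMap Y (0, v)).2 = -((1 / 2 : ℝ) • v) := by rw [weylMap_apply, zero_sub]
  change φ (weylMap Y (x, 0)).1 * fderiv ℝ ψ x (weylMap Y (0, v)).2 +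
    ψ (weylMap Y (x, 0)).2 * fderiv ℝ φ x (weylMap Y (0, v)).1 = _
  rw [e1, e2, hw, map_neg, map_smul, map_smul, Complex.real_smul, Complex.real_smul]
  push_cast
  ring

/-- The pointwise product of Schwartz functions. -/
noncomputable def schwartzMul (f g : 𝓢(Y, ℂ)) : 𝓢(Y, ℂ) :=
  compCLMOfAntilipschitz ℂ (K := 1)
    ((ContinuousLinearMap.id ℝ Y).prod (ContinuousLinearMap.id ℝ Y)).hasTemperateGrowth
    (by
      refine AntilipschitzWith.of_le_mul_dist fun x y => ?_
      simp [dist_eq_norm, Prod.norm_def]) (tensor f g)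

theorem integrable_mul_schwartz (f g : 𝓢(Y, ℂ)) : Integrable (fun y => f y * g y) :=
  (schwartzMul f g).integrable

/-- Integrating out the momentum restricts to the diagonal. The `l` part gives multiplication; the
`v` part gives (i/2)(∂φ ψ - φ ∂ψ), which integration by parts turns into -i φ ∂ψ. -/
theorem weylKernel_linear
    (h : ∀ Φ : 𝓢(Y × Y, ℂ), partialFourier (partialFourierInv Φ) = Φ) (l : Y →L[ℝ] ℝ) (v : Y)
    (b : 𝓢'(Y × Y, ℂ)) (hb : ∀ f : 𝓢(Y × Y, ℂ), b f = ∫ z, ((l z.1 + dot v z.2 : ℝ) : ℂ) * f z)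
    (φ ψ : 𝓢(Y, ℂ)) : weylKernel Y b (tensor φ ψ) =
      ∫ x, ((l x : ℂ) * ψ x - Complex.I * fderiv ℝ ψ x v) * φ x := by
  have : ProperSpace Y := FiniteDimensional.proper ℝ Y
  set G := compCLMOfContinuousLinearEquiv ℂ (weylMap Y) (tensor φ ψ) with hG
  set c : ℂ := (((2 * Real.pi) ^ (-(Module.finrank ℝ Y : ℝ) / 2) : ℝ) : ℂ) with hc
  have hi := integrable_linear_mul (l.comp (ContinuousLinearMap.fst ℝ Y Y) +
    (dot v).comp (ContinuousLinearMap.snd ℝ Y Y)) (partialFourierInv G)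
  have hF : b (partialFourierInv G) = ∫ x, ∫ ξ, ((l x + dot v ξ : ℝ) : ℂ) *
      partialFourierInv G (x, ξ) := by
    rw [hb]
    exact integral_prod (μ := (volume : Measure Y)) (ν := (volume : Measure Y)) _ hi
  have hx : ∀ x, c * ∫ ξ, ((l x + dot v ξ : ℝ) : ℂ) * partialFourierInv G (x, ξ) =
      (l x : ℂ) * (φ x * ψ x) + Complex.I / 2 * (fderiv ℝ φ x v * ψ x - φ x * fderiv ℝ ψ x v) := by
    intro x
    have i1 : Integrable (fun ξ => (l x : ℂ) * partialFourierInv G (x, ξ)) :=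
      (osc_integrable (partialFourierInv G) x).const_mul _
    simp only [Complex.ofReal_add, add_mul]
    rw [integral_add i1 (integrable_dot_mul (partialFourierInv G) x v), integral_const_mul,
      mul_add, integral_dot_mul_partialFourierInv h, mul_left_comm, integral_partialFourierInv h,
      tensor_weylMap_zero, fderiv_tensor_weylMap_zero]
    ring
  have hD1 : Integrable (fun x => fderiv ℝ φ x v * ψ x) :=
    integrable_mul_schwartz (LineDeriv.lineDerivOp v φ) ψ
  have hD2 : Integrable (fun x => φ x * fderiv ℝ ψ x v) :=
    integrable_mul_schwartz φ (LineDeriv.lineDerivOp v ψ)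
  have hD3 : Integrable (fun x => (l x : ℂ) * (φ x * ψ x)) :=
    integrable_linear_mul l (schwartzMul φ ψ)
  have hD4 : Integrable (fun x => Complex.I / 2 *
      (fderiv ℝ φ x v * ψ x - φ x * fderiv ℝ ψ x v)) := (hD1.sub hD2).const_mul _
  have hparts : ∫ x, φ x * fderiv ℝ ψ x v = -∫ x, fderiv ℝ φ x v * ψ x :=
    integral_mul_fderiv_eq_neg_fderiv_mul_of_integrable hD1 hD2 (integrable_mul_schwartz φ ψ)
      (fun x _ => φ.differentiable x) (fun x _ => ψ.differentiable x)
  have hR : ∀ x, ((l x : ℂ) * ψ x - Complex.I * fderiv ℝ ψ x v) * φ x =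
      (l x : ℂ) * (φ x * ψ x) - Complex.I * (φ x * fderiv ℝ ψ x v) := fun x => by ring
  rw [weylKernel_apply, hF, ← hc, ← integral_const_mul]
  simp only [hx, hR]
  rw [integral_add hD3 hD4, integral_sub hD3 (hD2.const_mul _),
    integral_const_mul, integral_const_mul, integral_sub hD1 hD2, hparts]
  ring

end LinearSymbol

/-! ### Bopp operators of the coordinate functions -/

theorem boppSymbol_linearSymbol {n : ℕ} (L : (Vec n × Vec n) →L[ℝ] ℝ)
    (f : 𝓢((Vec n × Vec n) × (Vec n × Vec n), ℂ)) :
    boppSymbol n (linearSymbol n L) f = ∫ t, (L (boppMap n t).1 : ℂ) * f t := by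
  set g := compCLMOfContinuousLinearEquiv ℂ (boppMap n).symm f with hg
  have hi := integrable_linear_mul
    (L.comp (ContinuousLinearMap.fst ℝ (Vec n × Vec n) (Vec n × Vec n))) g
  have h1 := integral_prod (μ := (volume : Measure (Vec n × Vec n)))
    (ν := (volume : Measure (Vec n × Vec n))) _ hi
  have h2 := integral_comp_equiv (measurePreserving_boppMap (n := n))
    (fun t => (L t.1 : ℂ) * g t)
  have h3 : ∀ t, g (boppMap n t) = f t := fun t => by
    rw [hg, comp_equiv_apply, ContinuousLinearEquiv.symm_apply_apply]
  simp only [h3] at h2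
  rw [h2, boppSymbol_apply, linearSymbol_apply, ← hg]
  refine Eq.trans ?_ h1.symm
  congr 1
  ext z
  rw [partialIntegral_apply, mul_comm, ← integral_const_mul]
  rfl

theorem boppOp_linearSymbol {n : ℕ} (L : (Vec n × Vec n) →L[ℝ] ℝ) (v : Vec n × Vec n)
    (hL : ∀ t, L (boppMap n t).1 = L t.1 + dot v t.2) (Ψ Χ : 𝓢(Vec n × Vec n, ℂ)) :
    boppOp n (linearSymbol n L) Ψ Χ =
      ∫ z, ((L z : ℂ) * Ψ z - Complex.I * fderiv ℝ Ψ z v) * Χ z := by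
  rw [boppOp_eq_kernelOp, kernelOp_apply]
  refine weylKernel_linear partialFourier_partialFourierInv_prod L v _ (fun f => ?_) Χ Ψ
  rw [boppSymbol_linearSymbol]
  simp only [hL]

end Bopp

theorem theorem20 (n : ℕ) :
    (∀ a : 𝓢'(Bopp.Vec n × Bopp.Vec n, ℂ),
      Bopp.IsWeylSymbol (Bopp.Vec n × Bopp.Vec n) (Bopp.boppOp n a) (Bopp.boppSymbol n a)) ∧
    (∀ (j : Fin n) (Ψ Χ : 𝓢(Bopp.Vec n × Bopp.Vec n, ℂ)),
      Bopp.boppOp n (Bopp.linearSymbol n ((EuclideanSpace.proj j).comp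
          (ContinuousLinearMap.fst ℝ (Bopp.Vec n) (Bopp.Vec n)))) Ψ Χ =
        ∫ z : Bopp.Vec n × Bopp.Vec n, ((z.1 j : ℂ) * Ψ z +
          Complex.I / 2 * fderiv ℝ Ψ z (0, EuclideanSpace.single j 1)) * Χ z) ∧
    (∀ (j : Fin n) (Ψ Χ : 𝓢(Bopp.Vec n × Bopp.Vec n, ℂ)),
      Bopp.boppOp n (Bopp.linearSymbol n ((EuclideanSpace.proj j).comp
          (ContinuousLinearMap.snd ℝ (Bopp.Vec n) (Bopp.Vec n)))) Ψ Χ =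
        ∫ z : Bopp.Vec n × Bopp.Vec n, ((z.2 j : ℂ) * Ψ z -
          Complex.I / 2 * fderiv ℝ Ψ z (EuclideanSpace.single j 1, 0)) * Χ z) := by
  refine ⟨Bopp.isWeylSymbol_boppOp, fun j Ψ Χ => ?_, fun j Ψ Χ => ?_⟩
  -- The symbol is x_j - (ξ_p)_j/2, so `v` is minus half the j-th unit vector of the p-direction.
  · rw [Bopp.boppOp_linearSymbol _ (-(1 / 2 : ℝ) • (0, EuclideanSpace.single j 1))]
    · congr 1
      ext z
      rw [map_smul, Complex.real_smul]
      change ((z.1 j : ℂ) * Ψ z - _) * Χ z = _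
      push_cast
      ring
    · rintro ⟨⟨x, p⟩, ξ, η⟩
      rw [Bopp.boppMap_apply, map_smul]
      change (x - (1 / 2 : ℝ) • η) j = x j + -(1 / 2) * (inner ℝ (0 : Bopp.Vec n) ξ +
        inner ℝ (EuclideanSpace.single j (1 : ℝ)) η)
      simp [EuclideanSpace.inner_single_left]
      ring
  -- The symbol is p_j + (ξ_x)_j/2, hence half the j-th unit vector of the x-direction.
  · rw [Bopp.boppOp_linearSymbol _ ((1 / 2 : ℝ) • (EuclideanSpace.single j 1, 0))]
    · congr 1
      ext z
      rw [map_smul, Complex.real_smul]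
      change ((z.2 j : ℂ) * Ψ z - _) * Χ z = _
      push_cast
      ring
    · rintro ⟨⟨x, p⟩, ξ, η⟩
      rw [Bopp.boppMap_apply, map_smul]
      change (p + (1 / 2 : ℝ) • ξ) j = p j + 1 / 2 * (inner ℝ (EuclideanSpace.single j (1 : ℝ)) ξ +
        inner ℝ (0 : Bopp.Vec n) η)
      simp [EuclideanSpace.inner_single_left]
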